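/- Consider $n$ advertisers with independent values $v_i \ge 0$; $v_i$ has density $f_i$, distribution function $F_i$ and finite mean, and $F_i$ is regular: the virtual value $\phi_i(v) = v - \frac{1-F_i(v)}{f_i(v)}$ is non-decreasing on $[0,\infty)$ (with $\phi_i(v) = -\infty$ if $f_i(v)=0$ and $F_i(v)<1$, $\phi_i(v)=v$ if $f_i(v)=0$ and $F_i(v)=1$, and $0\cdot(-\infty)=0$). A single-slot incentive compatible (IC) mechanism consists of measurable allocation probabilities $x_i(v)\ge 0$ with $\sum_i x_i(v)\le 1$ and expected payments $p_i(v)\ge 0$ such that truthful bidding is, whatever the bids of the others, optimal for each bidder and gives that bidder nonnegative utility. The state of the user is a click-through rate $\mathrm{ctr}\in[0,1]$. In state $\mathrm{ctr}$ the mechanism $a=(x,p)$ has reward $R(a,\mathrm{ctr}) = \mathrm{ctr}\cdot \mathbb{E}_v[\sum_i p_i(v)]$, and the next state has law $P(\cdot\mid a,\mathrm{ctr}) = \sum_i \mathbb{E}_v[x_i(v)]\,P_i(\cdot\mid\mathrm{ctr}) + (1-\sum_i \mathbb{E}_v[x_i(v)])\,P_0(\cdot\mid\mathrm{ctr})$,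 where $P_i$ and $P_0$ are given Markov kernels (ad $i$ is shown, respectively no ad is shown). A policy $\pi$ chooses measurably an IC mechanism in each state. Let $\gamma\in[0,1)$, $V^\pi(\mathrm{ctr}_0)=\mathbb{E}\big[\sum_{t\ge0}\gamma^t R(\pi(\mathrm{ctr}_t),\mathrm{ctr}_t)\big]$ with $\mathrm{ctr}_{t+1}\sim P(\cdot\mid\pi(\mathrm{ctr}_t),\mathrm{ctr}_t)$, and $V^*=\sup_\pi V^\pi$; $\pi$ is optimal if $V^{\pi'}(\mathrm{ctr})\le V^{\pi}(\mathrm{ctr})$ for all policies $\pi'$ and all states $\mathrm{ctr}$. Define the modified virtual value $$\tilde\phi_i(v_i,\mathrm{ctr}) = \mathrm{ctr}\cdot\phi_i(v_i) + \gamma\left(\mathbb{E}_{\mathrm{ctr}'\sim P_i(\cdot\mid\mathrm{ctr})}[V^*(\mathrm{ctr}')] - \mathbb{E}_{\mathrm{ctr}'\sim P_0(\cdot\mid\mathrm{ctr})}[V^*(\mathrm{ctr}')]\right).$$ Then in each state the optimal IC mechanism allocates the slot to an advertiser with the largest modified virtual value if at least one modified virtual value is positive, and otherwise does not allocate. Precisely: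 (1) there is a policy that follows this rule in every state and for all bids $v\ge0$, with all allocation probabilities in $\{0,1\}$; (2) every policy that follows this rule in every state and for all bids, with arbitrary (possibly randomized) tie-breaking, is optimal and attains $V^*$; (3) if a policy is optimal, then in every state, for almost every value vector $v$, it allocates only to advertisers whose modified virtual value is largest and nonnegative, and it allocates with total probability $1$ if some modified virtual value is positive. -/

import Mathlib

open MeasureTheory ProbabilityTheory
open scoped ENNReal

noncomputable section

/-- A value distribution on `[0, ∞)`, given by its probability density function. -/
structure ValueDist where
  pdf : ℝ → ℝ
  measurable_pdf : Measurable pdf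
  pdf_nonneg : ∀ v, 0 ≤ pdf v
  pdf_neg : ∀ v, v < 0 → pdf v = 0
  lintegral_pdf : ∫⁻ v, ENNReal.ofReal (pdf v) = 1

namespace ValueDist

/-- The law of the value. -/
def law (F : ValueDist) : Measure ℝ :=
  volume.withDensity (fun v => ENNReal.ofReal (F.pdf v))

instance (F : ValueDist) : IsProbabilityMeasure F.law :=
  ⟨by simp [law, F.lintegral_pdf]⟩

theorem ae_nonneg (F : ValueDist) : ∀ᵐ v ∂F.law, 0 ≤ v := by
  have hm : Measurable (fun v => ENNReal.ofReal (F.pdf v)) :=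
    F.measurable_pdf.ennreal_ofReal
  rw [law, ae_withDensity_iff hm]
  refine Filter.Eventually.of_forall fun v hv => ?_
  by_contra h
  exact hv (by simp [F.pdf_neg v (not_le.mp h)])

/-- The virtual value `φ(v) = v - (1 - F(v)) / f(v)`. The quotient is taken in `[0, ∞]`, so that
`φ(v) = -∞` if `f(v) = 0` and `F(v) < 1`, and `φ(v) = v` if `f(v) = 0` and `F(v) = 1`. -/
def virtualValue (F : ValueDist) (v : ℝ) : EReal :=
  (v : EReal) -
    ((ENNReal.ofReal (1 - cdf F.law v) / ENNReal.ofReal (F.pdf v) : ℝ≥0∞) : EReal)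

/-- A distribution is regular if its virtual value is non-decreasing on `[0, ∞)`. -/
def IsRegular (F : ValueDist) : Prop :=
  MonotoneOn F.virtualValue (Set.Ici 0)

end ValueDist

/-- A (possibly randomized) single-slot mechanism for `n` bidders that is incentive compatible:
`alloc v i` is the probability that `i` wins the slot and `pay v i` is the expected payment of `i`
when the bids are `v`. Only the values at nonnegative bids matter. -/
structure ICMechanism (n : ℕ) where
  alloc : (Fin n → ℝ) → Fin n → ℝ
  pay : (Fin n → ℝ) → Fin n → ℝ
  measurable_alloc : Measurable alloc
  measurable_pay : Measurable pay
  alloc_nonneg : ∀ v, 0 ≤ v → ∀ i, 0 ≤ alloc v i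
  sum_alloc_le_one : ∀ v, 0 ≤ v → ∑ i, alloc v i ≤ 1
  pay_nonneg : ∀ v, 0 ≤ v → ∀ i, 0 ≤ pay v i
  /-- Incentive compatibility: truthful bidding is optimal whatever the others bid. -/
  truthful : ∀ v, 0 ≤ v → ∀ i, ∀ b, 0 ≤ b →
    v i * alloc (Function.update v i b) i - pay (Function.update v i b) i
      ≤ v i * alloc v i - pay v i
  /-- Individual rationality: a truthful bidder has nonnegative utility. -/
  rational : ∀ v, 0 ≤ v → ∀ i, pay v i ≤ v i * alloc v i

/-- The state of the user, a click-through rate. -/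
abbrev UserState : Type := Set.Icc (0 : ℝ) 1

/-- A policy chooses an IC mechanism in each state, measurably in the state and the bids. -/
structure Policy (n : ℕ) where
  mech : UserState → ICMechanism n
  measurable_alloc : Measurable fun q : UserState × (Fin n → ℝ) => (mech q.1).alloc q.2
  measurable_pay : Measurable fun q : UserState × (Fin n → ℝ) => (mech q.1).pay q.2

/-- The data of the repeated auction: value distributions of the `n` advertisers, the law
`P W ctr` of the next state when the set `W` of ads is shown in state `ctr`, and the discount
factor. -/
structure AdMDP (n : ℕ) where
  F : Fin n → ValueDist
  P : Finset (Fin n) → Kernel UserState UserState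
  markov : ∀ W, IsMarkovKernel (P W)
  γ : ℝ
  γ_nonneg : 0 ≤ γ
  γ_lt_one : γ < 1

namespace AdMDP

variable {n : ℕ} (M : AdMDP n)

instance (W : Finset (Fin n)) : IsMarkovKernel (M.P W) := M.markov W

/-- The joint law of the (independent) values. -/
def valueLaw : Measure (Fin n → ℝ) :=
  Measure.pi fun i => (M.F i).law

instance : IsProbabilityMeasure M.valueLaw := by
  unfold valueLaw; infer_instance

theorem ae_nonneg : ∀ᵐ v ∂M.valueLaw, (0 : Fin n → ℝ) ≤ v := by
  have h : ∀ i, ∀ᵐ v ∂M.valueLaw, 0 ≤ v i := fun i =>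
    (measurePreserving_eval (fun i => (M.F i).law) i).quasiMeasurePreserving.ae
      (M.F i).ae_nonneg
  filter_upwards [ae_all_iff.mpr h] with v hv i using hv i

/-- The probability that advertiser `i` wins the slot. -/
def winProb (a : ICMechanism n) (i : Fin n) : ℝ :=
  ∫ v, a.alloc v i ∂M.valueLaw

/-- The expected reward `R(a, ctr) = ctr * E[∑ i, p_i(v)]`. -/
def reward (a : ICMechanism n) (c : UserState) : ℝ :=
  (c : ℝ) * ∫ v, ∑ i, a.pay v i ∂M.valueLaw

/-- The law `P(· | a, ctr)` of the next state: the average of `P W ctr` over the set `W` of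
winners, which is `{i}` with probability `winProb a i`, and otherwise empty. -/
def transition (a : ICMechanism n) (c : UserState) : Measure UserState :=
  ∑ i, ENNReal.ofReal (M.winProb a i) • M.P {i} c +
    ENNReal.ofReal (1 - ∑ i, M.winProb a i) • M.P ∅ c

theorem integrable_alloc (a : ICMechanism n) (i : Fin n) :
    Integrable (fun v => a.alloc v i) M.valueLaw := by
  refine Integrable.mono' (integrable_const (1 : ℝ))
    ((measurable_pi_apply i).comp a.measurable_alloc).aestronglyMeasurable ?_
  filter_upwards [M.ae_nonneg] with v hv
  rw [Real.norm_of_nonneg (a.alloc_nonneg v hv i)]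
  exact (Finset.single_le_sum (fun j _ => a.alloc_nonneg v hv j) (Finset.mem_univ i)).trans
    (a.sum_alloc_le_one v hv)

theorem winProb_nonneg (a : ICMechanism n) (i : Fin n) : 0 ≤ M.winProb a i := by
  refine integral_nonneg_of_ae ?_
  filter_upwards [M.ae_nonneg] with v hv using a.alloc_nonneg v hv i

theorem sum_winProb_le_one (a : ICMechanism n) : ∑ i, M.winProb a i ≤ 1 := by
  unfold winProb
  rw [← integral_finsetSum _ fun i _ => M.integrable_alloc a i]
  calc ∫ v, ∑ i, a.alloc v i ∂M.valueLaw ≤ ∫ _, (1 : ℝ) ∂M.valueLaw := by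
        refine integral_mono_ae (integrable_finsetSum _ fun i _ => M.integrable_alloc a i)
          (integrable_const _) ?_
        filter_upwards [M.ae_nonneg] with v hv using a.sum_alloc_le_one v hv
    _ = 1 := by simp

theorem isProbabilityMeasure_transition (a : ICMechanism n) (c : UserState) :
    IsProbabilityMeasure (M.transition a c) := by
  constructor
  simp only [transition, Measure.coe_add, Measure.coe_finsetSum, Measure.coe_smul, Pi.add_apply,
    Finset.sum_apply, Pi.smul_apply, measure_univ, smul_eq_mul, mul_one]
  rw [← ENNReal.ofReal_sum_of_nonneg fun i _ => M.winProb_nonneg a i,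
    ← ENNReal.ofReal_add (Finset.sum_nonneg fun i _ => M.winProb_nonneg a i)
      (sub_nonneg.mpr (M.sum_winProb_le_one a))]
  simp

theorem measurable_winProb (π : Policy n) (i : Fin n) :
    Measurable fun c => M.winProb (π.mech c) i := by
  have h : StronglyMeasurable fun q : UserState × (Fin n → ℝ) => (π.mech q.1).alloc q.2 i :=
    ((measurable_pi_apply i).comp π.measurable_alloc).stronglyMeasurable
  exact h.integral_prod_right'.measurable

/-- The transition kernel of the states under a policy. -/
def stepKernel (π : Policy n) : Kernel UserState UserState where
  toFun c := M.transition (π.mech c) c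
  measurable' := by
    refine Measure.measurable_of_measurable_coe _ fun s hs => ?_
    simp only [transition, Measure.coe_add, Measure.coe_finsetSum, Measure.coe_smul,
      Pi.add_apply, Finset.sum_apply, Pi.smul_apply, smul_eq_mul]
    have h := M.measurable_winProb π
    refine Measurable.add (Finset.measurable_fun_sum _ fun i _ => ?_) ?_
    · exact (h i).ennreal_ofReal.mul ((M.P {i}).measurable_coe hs)
    · exact (measurable_const.sub (Finset.measurable_fun_sum _ fun i _ => h i)).ennreal_ofReal.mul
        ((M.P ∅).measurable_coe hs)

instance (π : Policy n) : IsMarkovKernel (M.stepKernel π) :=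
  ⟨fun c => M.isProbabilityMeasure_transition (π.mech c) c⟩

/-- The law of the trajectory `(ctr_0, ctr_1, …)` of the Markov chain of user states that starts
at `ctr_0 = c` and satisfies `ctr_{t+1} ∼ P(· | π(ctr_t), ctr_t)`. -/
def trajLaw (π : Policy n) (c : UserState) : Measure (ℕ → UserState) :=
  Kernel.traj (X := fun _ => UserState)
    (fun t => (M.stepKernel π).comap
      (fun h : (Π _ : Finset.Iic t, UserState) => h ⟨t, Finset.mem_Iic.mpr le_rfl⟩)
      (measurable_pi_apply _)) 0 (fun _ => c)

/-- The long-term discounted revenue `V^π`. -/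
def value (π : Policy n) (c : UserState) : ℝ :=
  ∫ s, ∑' t : ℕ, M.γ ^ t * M.reward (π.mech (s t)) (s t) ∂(M.trajLaw π c)

/-- The optimal value function `V^*(ctr) = sup_π V^π(ctr)`. -/
def optValue (c : UserState) : ℝ :=
  ⨆ π : Policy n, M.value π c

/-- A policy is optimal if it has the largest long-term revenue from every initial state. -/
def IsOptimal (π : Policy n) : Prop :=
  ∀ (c : UserState) (π' : Policy n), M.value π' c ≤ M.value π c

/-- The modified virtual value
`ctr * φ_i(v_i) + γ * (E_{P_i(· | ctr)}[V^*] - E_{P_0(· | ctr)}[V^*])`. -/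
def modifiedVirtualValue (i : Fin n) (vi : ℝ) (c : UserState) : EReal :=
  ((c : ℝ) : EReal) * (M.F i).virtualValue vi +
    ((M.γ * (∫ c', M.optValue c' ∂(M.P {i} c) - ∫ c', M.optValue c' ∂(M.P ∅ c)) : ℝ) : EReal)

/-- Advertiser `i` has the largest modified virtual value. -/
def IsMaximizer (v : Fin n → ℝ) (c : UserState) (i : Fin n) : Prop :=
  ∀ j, M.modifiedVirtualValue j (v j) c ≤ M.modifiedVirtualValue i (v i) c

/-- In state `c` and for all bids, the mechanism allocates the slot to an advertiser with the
largest modified virtual value (ties may be broken arbitrarily) if one of these values is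
positive, and otherwise does not allocate. -/
def AllocatesToMaximizer (a : ICMechanism n) (c : UserState) : Prop :=
  ∀ v : Fin n → ℝ, 0 ≤ v →
    ((∃ i, 0 < M.modifiedVirtualValue i (v i) c) →
      ∑ i, a.alloc v i = 1 ∧ ∀ i, a.alloc v i ≠ 0 → M.IsMaximizer v c i) ∧
    ((∀ i, M.modifiedVirtualValue i (v i) c ≤ 0) → ∀ i, a.alloc v i = 0)

end AdMDP

end

/-! The proof combines Myerson's payment identity with dynamic programming. Fix a bounded measurable
continuation value `W`. In an IC mechanism a zero bid pays zero, so the allocation determines the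
payments (`pay_eq_of_truthful`). Integrating over one bidder's value, expected revenue is the
expected virtual surplus minus a nonnegative loss, carried by the set where the density vanishes and
the distribution function is below one (`ValueDist.integral_pay_add_loss`). Hence reward plus
discounted continuation is at most the expectation of an average of scores: `ctr * φ_i + γ E_{P_i}
W` for showing ad `i`, and `γ E_{P_0} W` for showing none. This average is at most the maximal
score, whose expectation is `bellman W`.

The modified virtual value is a score minus the no-ad score, so maximizing scores is the rule of the
theorem. Regularity makes this rule monotone in each bid, hence implementable. The rule also avoids
the values with `φ_i = -∞` unless `ctr = 0`, where revenue is irrelevant, so it attains the bound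
(`IsGreedy.qValue_eq`). Conversely, a mechanism attaining the bound maximizes the score almost
surely (`ae_greedy_of_qValue_eq`).

The Bellman operator is a `γ`-contraction in the sup norm, so it has a fixed point `W`
(`exists_bellman_eq`). Telescoping along trajectories gives `V^π - Q_W(π) = ∑ γ^(t+1) E[(Q_W -
W)(ctr_{t+1})]` (`hasSum_value_sub_qValue`). For the fixed point the terms are nonpositive, and zero
for greedy policies; hence `V^π ≤ Q_W(π) ≤ W`, with equality for greedy ones, and `W = V^*`. An
optimal policy turns this chain into equalities in every state. -/

noncomputable section

/-! ### The envelope formula for truthful payments. -/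

/-- A function whose increments are dominated by `(t - s) * (x t - x s)` is constant. -/
theorem eq_zero_value_of_abs_sub_le {H x : ℝ → ℝ}
    (h : ∀ s t, 0 ≤ s → s ≤ t → |H t - H s| ≤ (t - s) * (x t - x s)) {b : ℝ} (hb : 0 ≤ b) :
    H b = H 0 := by
  -- Cutting `[0, b]` into `N` equal pieces makes the increments of `x` telescope, with the common
  -- factor `b / N`. Letting `N` grow then forces the difference to zero.
  have key : ∀ N : ℕ, 0 < N → |H b - H 0| ≤ b / N * (x b - x 0) := by
    intro N hN
    have hN' : (0 : ℝ) < N := by exact_mod_cast hN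
    have hd : 0 ≤ b / N := by positivity
    have step : ∀ k : ℕ, |H (k * (b / N)) - H 0| ≤ b / N * (x (k * (b / N)) - x 0) := by
      intro k
      induction k with
      | zero => simp
      | succ k ih =>
        have h1 := h (k * (b / N)) ((k + 1 : ℕ) * (b / N)) (by positivity)
          (by push_cast; nlinarith)
        have h2 : (((k + 1 : ℕ) : ℝ) * (b / N) - k * (b / N)) = b / N := by push_cast; ring
        rw [h2] at h1
        have h3 := abs_sub_le (H ((k + 1 : ℕ) * (b / N))) (H (k * (b / N))) (H 0)
        linarith
    have := step N
    rwa [mul_div_cancel₀ _ hN'.ne'] at this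
  by_contra hne
  have hpos : 0 < |H b - H 0| := abs_pos.mpr (sub_ne_zero.mpr hne)
  obtain ⟨N, hN⟩ := exists_nat_gt (b * (x b - x 0) / |H b - H 0|)
  rw [div_lt_iff₀ hpos] at hN
  have h1 := key (N + 1) N.succ_pos
  rw [div_mul_eq_mul_div, le_div_iff₀ (by positivity)] at h1
  push_cast at h1
  nlinarith

/-- Adding the constraints "`s` does not imitate `t`" and "`t` does not imitate `s`" cancels the
payments and leaves `(t - s) * (x t - x s) ≥ 0`. -/
theorem monotoneOn_alloc_of_truthful {x p : ℝ → ℝ}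
    (h : ∀ s t, 0 ≤ s → 0 ≤ t → s * x t - p t ≤ s * x s - p s) :
    MonotoneOn x (Set.Ici 0) := by
  intro s hs t ht hst
  have h1 := h s t hs ht
  have h2 := h t s ht hs
  rcases hst.eq_or_lt with rfl | hlt
  · exact le_rfl
  · by_contra hc
    nlinarith

theorem MonotoneOn.intervalIntegrable_of_Ici {x : ℝ → ℝ} (hx : MonotoneOn x (Set.Ici 0))
    {s t : ℝ} (hs : 0 ≤ s) (ht : 0 ≤ t) : IntervalIntegrable x volume s t :=
  MonotoneOn.intervalIntegrable (hx.mono fun _ hr => (le_min hs ht).trans hr.1)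

theorem MonotoneOn.integral_mem_of_Ici {x : ℝ → ℝ} (hx : MonotoneOn x (Set.Ici 0))
    {s t : ℝ} (hs : 0 ≤ s) (hst : s ≤ t) :
    (t - s) * x s ≤ ∫ r in s..t, x r ∧ ∫ r in s..t, x r ≤ (t - s) * x t := by
  have hi := hx.intervalIntegrable_of_Ici hs (hs.trans hst)
  constructor
  · have := intervalIntegral.integral_mono_on hst (f := fun _ => x s) (by simp) hi
      fun r hr => hx hs (hs.trans hr.1) hr.1
    simpa using this
  · have := intervalIntegral.integral_mono_on hst (g := fun _ => x t) hi (by simp)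
      fun r hr => hx (hs.trans hr.1) (hs.trans hst) hr.2
    simpa using this

/-- The payments of a truthful mechanism are determined by the allocation. -/
theorem pay_eq_of_truthful {x p : ℝ → ℝ}
    (h : ∀ s t, 0 ≤ s → 0 ≤ t → s * x t - p t ≤ s * x s - p s) (hp : p 0 = 0)
    {b : ℝ} (hb : 0 ≤ b) : p b = b * x b - ∫ s in (0 : ℝ)..b, x s := by
  have hx := monotoneOn_alloc_of_truthful h
  have := eq_zero_value_of_abs_sub_le (x := x)
    (H := fun t => t * x t - p t - ∫ s in (0 : ℝ)..t, x s) ?_ hb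
  · simp only [hp, intervalIntegral.integral_same] at this
    linarith
  -- The increments of the utility and of the integral of `x` both lie between `(t - s) * x s` and
  -- `(t - s) * x t`, so they differ by at most the length of that interval.
  · intro s t hs hst
    have ht := hs.trans hst
    have h1 := h s t hs ht
    have h2 := h t s ht hs
    have h3 := hx.integral_mem_of_Ici hs hst
    have h4 := intervalIntegral.integral_add_adjacent_intervals
      (hx.intervalIntegrable_of_Ici le_rfl hs) (hx.intervalIntegrable_of_Ici hs ht)
    rw [← h4]
    rw [abs_le]
    constructor <;> nlinarith [h3.1, h3.2]

/-! ### Expected revenue of one bidder as virtual surplus. -/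

namespace ValueDist

variable (F : ValueDist)

/-- The virtual value as a real number; it is the true virtual value where the density is
positive. -/
def realVirtualValue (v : ℝ) : ℝ := v - (1 - cdf F.law v) / F.pdf v

theorem measurable_cdf : Measurable (cdf F.law) := (monotone_cdf F.law).measurable

theorem measurable_realVirtualValue : Measurable F.realVirtualValue :=
  measurable_id.sub ((measurable_const.sub F.measurable_cdf).div F.measurable_pdf)

theorem ae_pdf_pos : ∀ᵐ v ∂F.law, 0 < F.pdf v := by
  rw [law, ae_withDensity_iff F.measurable_pdf.ennreal_ofReal]
  exact Filter.Eventually.of_forall fun v hv => by simpa using hv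

theorem law_Ioi (s : ℝ) : F.law (Set.Ioi s) = ENNReal.ofReal (1 - cdf F.law s) := by
  rw [← Set.compl_Iic, prob_compl_eq_one_sub measurableSet_Iic, cdf_eq_real,
    ENNReal.ofReal_sub _ measureReal_nonneg]
  simp

/-- By the layer-cake formula the integral of the tail is the mean. -/
theorem integrableOn_tail (hm : Integrable (fun v : ℝ => v) F.law) :
    IntegrableOn (fun s => 1 - cdf F.law s) (Set.Ioi 0) := by
  refine ⟨(measurable_const.sub F.measurable_cdf).aestronglyMeasurable, ?_⟩
  rw [hasFiniteIntegral_iff_ofReal (Filter.Eventually.of_forall fun s =>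
    sub_nonneg.mpr (cdf_le_one _ _))]
  have : ∫⁻ v, ENNReal.ofReal v ∂F.law = ∫⁻ t in Set.Ioi 0, F.law (Set.Ioi t) :=
    lintegral_eq_lintegral_meas_lt F.law F.ae_nonneg aemeasurable_id
  simp_rw [← F.law_Ioi]
  have h2 := hm.lintegral_lt_top
  rwa [this] at h2

theorem integrable_law_iff {g : ℝ → ℝ} :
    Integrable g F.law ↔ Integrable (fun v => F.pdf v * g v) := by
  rw [law, integrable_withDensity_iff_integrable_smul' F.measurable_pdf.ennreal_ofReal (by simp)]
  simp [ENNReal.toReal_ofReal (F.pdf_nonneg _)]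

theorem integral_law (g : ℝ → ℝ) : ∫ v, g v ∂F.law = ∫ v, F.pdf v * g v := by
  rw [law, integral_withDensity_eq_integral_toReal_smul F.measurable_pdf.ennreal_ofReal (by simp)]
  simp [ENNReal.toReal_ofReal (F.pdf_nonneg _)]

/-- Multiplication by the density cancels the quotient where the density is positive; elsewhere both
sides are zero. Only the null point `s = 0` has to be excluded, since the density vanishes on
negative values. -/
theorem pdf_mul_eq_indicator (y : ℝ → ℝ) :
    ∀ᵐ s, F.pdf s * (y s * ((1 - cdf F.law s) / F.pdf s)) =
      (Set.Ioi 0).indicator (({s | 0 < F.pdf s}).indicator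
        fun s => y s * (1 - cdf F.law s)) s := by
  have h0 : ∀ᵐ s : ℝ, s ≠ 0 := by simp [ae_iff]
  filter_upwards [h0] with s hs
  by_cases h1 : 0 < F.pdf s
  · have h2 : 0 < s := lt_of_le_of_ne (le_of_not_gt fun h => h1.ne' (F.pdf_neg s h)) hs.symm
    simp only [Set.indicator, Set.mem_Ioi, h2, Set.mem_ofPred_eq, h1, if_true]
    field_simp
  · have : F.pdf s = 0 := le_antisymm (not_lt.mp h1) (F.pdf_nonneg s)
    simp [Set.indicator, this]

theorem measurableSet_pdf_pos : MeasurableSet {s | 0 < F.pdf s} :=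
  measurableSet_lt measurable_const F.measurable_pdf

theorem integrableOn_mul_tail (hm : Integrable (fun v : ℝ => v) F.law) {y : ℝ → ℝ}
    (hy : Measurable y) (hy0 : ∀ s, 0 ≤ s → 0 ≤ y s) (hy1 : ∀ s, 0 ≤ s → y s ≤ 1) :
    IntegrableOn (fun s => y s * (1 - cdf F.law s)) (Set.Ioi 0) := by
  refine (F.integrableOn_tail hm).bdd_mul (c := 1) hy.aestronglyMeasurable ?_
  filter_upwards [ae_restrict_mem measurableSet_Ioi] with s hs
  rw [Real.norm_of_nonneg (hy0 s (le_of_lt hs))]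
  exact hy1 s (le_of_lt hs)

theorem integrable_mul_div (hm : Integrable (fun v : ℝ => v) F.law) {y : ℝ → ℝ}
    (hy : Measurable y) (hy0 : ∀ s, 0 ≤ s → 0 ≤ y s) (hy1 : ∀ s, 0 ≤ s → y s ≤ 1) :
    Integrable (fun s => y s * ((1 - cdf F.law s) / F.pdf s)) F.law := by
  rw [integrable_law_iff, integrable_congr (F.pdf_mul_eq_indicator y),
    integrable_indicator_iff measurableSet_Ioi]
  exact (F.integrableOn_mul_tail hm hy hy0 hy1).indicator F.measurableSet_pdf_pos

theorem integrable_realVirtualValue (hm : Integrable (fun v : ℝ => v) F.law) :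
    Integrable F.realVirtualValue F.law := by
  refine hm.sub ?_
  simpa using F.integrable_mul_div hm (y := fun _ => 1) measurable_const (by simp) (by simp)

/-- The expected information rent, as an integral over the values. -/
theorem integral_rent (hm : Integrable (fun v : ℝ => v) F.law) {x : ℝ → ℝ}
    (hx : Measurable x) (hx0 : ∀ s, 0 ≤ s → 0 ≤ x s) (hx1 : ∀ s, 0 ≤ s → x s ≤ 1)
    (hmono : MonotoneOn x (Set.Ici 0)) :
    Integrable (fun b => ∫ s in (0 : ℝ)..b, x s) F.law ∧
    ∫ b, (∫ s in (0 : ℝ)..b, x s) ∂F.law = ∫ s in Set.Ioi 0, x s * (1 - cdf F.law s) := by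
  -- Weighted layer-cake formula: the expectation of `∫_0^b x` is the integral of `x s` times the
  -- probability that the value exceeds `s`.
  have key := lintegral_comp_eq_lintegral_meas_lt_mul F.law (f := id) (g := x) F.ae_nonneg
    aemeasurable_id (fun t ht => hmono.intervalIntegrable_of_Ici le_rfl (le_of_lt ht))
    (by filter_upwards [ae_restrict_mem measurableSet_Ioi] with s hs using hx0 s (le_of_lt hs))
  simp only [id] at key
  have hi := F.integrableOn_mul_tail hm hx hx0 hx1
  have htail : ∀ s, 0 ≤ 1 - cdf F.law s := fun s => sub_nonneg.mpr (cdf_le_one _ _)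
  have hnn : ∀ᵐ s ∂(volume.restrict (Set.Ioi (0:ℝ))), 0 ≤ x s * (1 - cdf F.law s) := by
    filter_upwards [ae_restrict_mem measurableSet_Ioi] with s hs
    exact mul_nonneg (hx0 s (le_of_lt hs)) (htail s)
  have hr : ∫⁻ t in Set.Ioi 0, F.law {a | t < a} * ENNReal.ofReal (x t) =
      ∫⁻ s in Set.Ioi 0, ENNReal.ofReal (x s * (1 - cdf F.law s)) := by
    refine setLIntegral_congr_fun measurableSet_Ioi fun s hs => ?_
    rw [ENNReal.ofReal_mul (hx0 s (le_of_lt hs)), ← F.law_Ioi, mul_comm]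
    rfl
  rw [hr] at key
  -- For `b ≥ 0` the interval integral is an integral over the whole line of a jointly measurable
  -- function, hence measurable in `b`.
  have hU : AEStronglyMeasurable (fun b => ∫ s in (0 : ℝ)..b, x s) F.law := by
    have : Measurable (fun b : ℝ => ∫ s, (Set.Ioc 0 b).indicator x s) := by
      refine (StronglyMeasurable.integral_prod_right'
        (f := fun q : ℝ × ℝ => (Set.Ioc 0 q.1).indicator x q.2) ?_).measurable
      refine Measurable.stronglyMeasurable ?_
      have : (fun q : ℝ × ℝ => (Set.Ioc 0 q.1).indicator x q.2) =
          ({q : ℝ × ℝ | 0 < q.2 ∧ q.2 ≤ q.1}).indicator fun q => x q.2 := by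
        ext q; simp [Set.indicator]
      rw [this]
      exact (hx.comp measurable_snd).indicator
        ((measurableSet_lt measurable_const measurable_snd).inter
          (measurableSet_le measurable_snd measurable_fst))
    refine this.aestronglyMeasurable.congr ?_
    filter_upwards [F.ae_nonneg] with b hb
    rw [integral_indicator measurableSet_Ioc, intervalIntegral.integral_of_le hb]
  have hUnn : ∀ᵐ b ∂F.law, 0 ≤ ∫ s in (0 : ℝ)..b, x s := by
    filter_upwards [F.ae_nonneg] with b hb
    exact intervalIntegral.integral_nonneg hb fun s hs => hx0 s hs.1
  refine ⟨⟨hU, ?_⟩, ?_⟩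
  · rw [hasFiniteIntegral_iff_ofReal hUnn, key]
    exact hi.lintegral_lt_top
  · rw [integral_eq_lintegral_of_nonneg_ae hUnn hU, key,
      integral_eq_lintegral_of_nonneg_ae hnn hi.aestronglyMeasurable]

/-- Expected revenue from one bidder: virtual surplus minus the loss where the density vanishes. -/
theorem integral_pay_add_loss (hm : Integrable (fun v : ℝ => v) F.law) {x : ℝ → ℝ}
    (hx : Measurable x) (hx0 : ∀ s, 0 ≤ s → 0 ≤ x s) (hx1 : ∀ s, 0 ≤ s → x s ≤ 1)
    (hmono : MonotoneOn x (Set.Ici 0)) :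
    ∫ b, (b * x b - ∫ s in (0 : ℝ)..b, x s) ∂F.law +
      ∫ s in Set.Ioi 0, ({s | 0 < F.pdf s}ᶜ).indicator (fun s => x s * (1 - cdf F.law s)) s =
    ∫ b, x b * F.realVirtualValue b ∂F.law := by
  obtain ⟨hUi, hUe⟩ := F.integral_rent hm hx hx0 hx1 hmono
  have hi := F.integrableOn_mul_tail hm hx hx0 hx1
  have hbx : Integrable (fun b => b * x b) F.law := by
    have : Integrable (fun b => x b * b) F.law := by
      refine hm.bdd_mul (c := 1) hx.aestronglyMeasurable ?_
      filter_upwards [F.ae_nonneg] with s hs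
      rw [Real.norm_of_nonneg (hx0 s hs)]
      exact hx1 s hs
    simpa only [mul_comm] using this
  have h1 : ∫ b, x b * F.realVirtualValue b ∂F.law =
      ∫ b, b * x b ∂F.law - ∫ b, x b * ((1 - cdf F.law b) / F.pdf b) ∂F.law := by
    rw [← integral_sub hbx (F.integrable_mul_div hm hx hx0 hx1)]
    refine integral_congr_ae (Filter.Eventually.of_forall fun b => ?_)
    simp only [realVirtualValue]; ring
  -- The hazard term sees only the set of positive density, whereas the rent is integrated over all
  -- of `(0, ∞)`. The rest of the rent, split off in `h3`, is the loss.
  have h2 : ∫ b, x b * ((1 - cdf F.law b) / F.pdf b) ∂F.law =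
      ∫ s in Set.Ioi 0, ({s | 0 < F.pdf s}).indicator (fun s => x s * (1 - cdf F.law s)) s := by
    rw [integral_law, integral_congr_ae (F.pdf_mul_eq_indicator x),
      integral_indicator measurableSet_Ioi]
  have h3 : ∫ s in Set.Ioi 0, x s * (1 - cdf F.law s) =
      (∫ s in Set.Ioi 0, ({s | 0 < F.pdf s}).indicator (fun s => x s * (1 - cdf F.law s)) s) +
      ∫ s in Set.Ioi 0, ({s | 0 < F.pdf s}ᶜ).indicator (fun s => x s * (1 - cdf F.law s)) s := by
    rw [← integral_add (hi.indicator F.measurableSet_pdf_pos)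
      (hi.indicator F.measurableSet_pdf_pos.compl)]
    refine integral_congr_ae (Filter.Eventually.of_forall fun s => ?_)
    exact (congrFun (Set.indicator_self_add_compl {s | 0 < F.pdf s}
      (fun s => x s * (1 - cdf F.law s))) s).symm
  rw [integral_sub hbx hUi, hUe, h1, h2, h3]
  ring

theorem integral_pay_le (hm : Integrable (fun v : ℝ => v) F.law) {x : ℝ → ℝ}
    (hx : Measurable x) (hx0 : ∀ s, 0 ≤ s → 0 ≤ x s) (hx1 : ∀ s, 0 ≤ s → x s ≤ 1)
    (hmono : MonotoneOn x (Set.Ici 0)) :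
    ∫ b, (b * x b - ∫ s in (0 : ℝ)..b, x s) ∂F.law ≤
      ∫ b, x b * F.realVirtualValue b ∂F.law := by
  rw [← F.integral_pay_add_loss hm hx hx0 hx1 hmono]
  refine le_add_of_nonneg_right (integral_nonneg_of_ae ?_)
  filter_upwards [ae_restrict_mem measurableSet_Ioi] with s hs
  exact Set.indicator_apply_nonneg fun _ =>
    mul_nonneg (hx0 s (le_of_lt hs)) (sub_nonneg.mpr (cdf_le_one _ _))

/-- The loss vanishes: where the density is zero, either `F < 1` and `x` is zero by `hz`, or `F = 1`
and the tail factor is zero. -/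
theorem integral_pay_eq (hm : Integrable (fun v : ℝ => v) F.law) {x : ℝ → ℝ}
    (hx : Measurable x) (hx0 : ∀ s, 0 ≤ s → 0 ≤ x s) (hx1 : ∀ s, 0 ≤ s → x s ≤ 1)
    (hmono : MonotoneOn x (Set.Ici 0))
    (hz : ∀ s, 0 ≤ s → F.pdf s = 0 → cdf F.law s < 1 → x s = 0) :
    ∫ b, (b * x b - ∫ s in (0 : ℝ)..b, x s) ∂F.law =
      ∫ b, x b * F.realVirtualValue b ∂F.law := by
  rw [← F.integral_pay_add_loss hm hx hx0 hx1 hmono, setIntegral_congr_fun (g := fun _ => 0)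
    measurableSet_Ioi, integral_zero, add_zero]
  intro s hs
  refine Set.indicator_apply_eq_zero.mpr fun hs' => ?_
  have h0 : F.pdf s = 0 := le_antisymm (not_lt.mp hs') (F.pdf_nonneg s)
  rcases (cdf_le_one F.law s).lt_or_eq with h1 | h1
  · simp [hz s (le_of_lt hs) h0 h1]
  · simp [h1]

end ValueDist

/-! ### The payment identity for mechanisms with several bidders. -/

namespace ICMechanism

variable {n : ℕ} (a : ICMechanism n) {v : Fin n → ℝ}

theorem update_nonneg (hv : 0 ≤ v) (i : Fin n) {b : ℝ} (hb : 0 ≤ b) :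
    0 ≤ Function.update v i b := by
  intro j
  rcases eq_or_ne j i with rfl | h
  · simpa using hb
  · simpa [h] using hv j

theorem alloc_le_one (hv : 0 ≤ v) (i : Fin n) : a.alloc v i ≤ 1 :=
  (Finset.single_le_sum (fun j _ => a.alloc_nonneg v hv j) (Finset.mem_univ i)).trans
    (a.sum_alloc_le_one v hv)

theorem truthful_update (hv : 0 ≤ v) (i : Fin n) (s t : ℝ) (hs : 0 ≤ s) (ht : 0 ≤ t) :
    s * a.alloc (Function.update v i t) i - a.pay (Function.update v i t) i ≤
      s * a.alloc (Function.update v i s) i - a.pay (Function.update v i s) i := by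
  simpa using a.truthful _ (update_nonneg hv i hs) i t ht

theorem pay_update_eq (hv : 0 ≤ v) (i : Fin n) {b : ℝ} (hb : 0 ≤ b) :
    a.pay (Function.update v i b) i = b * a.alloc (Function.update v i b) i -
      ∫ s in (0 : ℝ)..b, a.alloc (Function.update v i s) i := by
  refine pay_eq_of_truthful (x := fun b => a.alloc (Function.update v i b) i)
    (p := fun b => a.pay (Function.update v i b) i) (a.truthful_update hv i) ?_ hb
  -- A zero bid pays at most `0 * alloc` by individual rationality and at least zero.
  refine le_antisymm ?_ (a.pay_nonneg _ (update_nonneg hv i le_rfl) i)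
  simpa using a.rational _ (update_nonneg hv i le_rfl) i

theorem monotoneOn_alloc (hv : 0 ≤ v) (i : Fin n) :
    MonotoneOn (fun b => a.alloc (Function.update v i b) i) (Set.Ici 0) :=
  monotoneOn_alloc_of_truthful (a.truthful_update hv i)

theorem measurable_alloc_apply (i : Fin n) : Measurable fun v => a.alloc v i :=
  (measurable_pi_apply i).comp a.measurable_alloc

theorem measurable_pay_apply (i : Fin n) : Measurable fun v => a.pay v i :=
  (measurable_pi_apply i).comp a.measurable_pay

end ICMechanism

namespace AdMDP

variable {n : ℕ} (M : AdMDP n)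

/-- Resampling one coordinate independently does not change a product law, as is seen on boxes. With
Fubini this freezes the other bids and reduces revenue to a single bidder. -/
theorem measurePreserving_update (i : Fin n) :
    MeasurePreserving (fun q : (Fin n → ℝ) × ℝ => Function.update q.1 i q.2)
      (M.valueLaw.prod (M.F i).law) M.valueLaw := by
  refine ⟨measurable_update', (Measure.pi_eq fun s hs => ?_).symm⟩
  have hpre : (fun q : (Fin n → ℝ) × ℝ => Function.update q.1 i q.2) ⁻¹' (Set.univ.pi s) =
      (Set.univ.pi (Function.update s i Set.univ)) ×ˢ (s i) := by
    ext ⟨v, b⟩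
    simp only [Set.mem_preimage, Set.mem_pi, Set.mem_univ, true_implies, Set.mem_prod]
    constructor
    · intro h
      refine ⟨fun j => ?_, by simpa using h i⟩
      rcases eq_or_ne j i with rfl | hj
      · simp
      · simpa [hj] using h j
    · rintro ⟨h, hb⟩ j
      rcases eq_or_ne j i with rfl | hj
      · simpa using hb
      · simpa [hj] using h j
  rw [Measure.map_apply measurable_update' (MeasurableSet.univ_pi hs), hpre, Measure.prod_prod,
    valueLaw, Measure.pi_pi]
  have : (fun j => (M.F j).law (Function.update s i Set.univ j)) =
      Function.update (fun j => (M.F j).law (s j)) i 1 := by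
    ext j
    rcases eq_or_ne j i with rfl | hj
    · simp
    · simp [hj]
  rw [this, Finset.prod_update_of_mem (Finset.mem_univ i), one_mul,
    ← Finset.prod_sdiff (Finset.subset_univ {i}), Finset.prod_singleton]

theorem integral_eq_integral_update (i : Fin n) {g : (Fin n → ℝ) → ℝ}
    (hg : Integrable g M.valueLaw) :
    Integrable (fun v => ∫ b, g (Function.update v i b) ∂(M.F i).law) M.valueLaw ∧
    ∫ v, g v ∂M.valueLaw = ∫ v, ∫ b, g (Function.update v i b) ∂(M.F i).law ∂M.valueLaw := by
  have hmp := M.measurePreserving_update i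
  have hi : Integrable (fun q : (Fin n → ℝ) × ℝ => g (Function.update q.1 i q.2))
      (M.valueLaw.prod (M.F i).law) := hmp.integrable_comp_of_integrable hg
  refine ⟨hi.integral_prod_left, ?_⟩
  rw [← integral_prod _ hi]
  conv_lhs => rw [← hmp.map_eq]
  exact integral_map hmp.measurable.aemeasurable (by rw [hmp.map_eq]; exact hg.aestronglyMeasurable)

theorem integrable_comp_eval (i : Fin n) {g : ℝ → ℝ} (hg : Integrable g (M.F i).law) :
    Integrable (fun v : Fin n → ℝ => g (v i)) M.valueLaw :=
  (measurePreserving_eval (fun i => (M.F i).law) i).integrable_comp_of_integrable hg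

theorem integral_comp_eval (i : Fin n) {g : ℝ → ℝ} (hg : Integrable g (M.F i).law) :
    ∫ v, g (v i) ∂M.valueLaw = ∫ b, g b ∂(M.F i).law := by
  have hmp := measurePreserving_eval (fun i => (M.F i).law) i
  rw [← hmp.map_eq, integral_map hmp.measurable.aemeasurable
    (by rw [hmp.map_eq]; exact hg.aestronglyMeasurable)]
  rfl

section FiniteMean

variable (hmean : ∀ i, Integrable (fun v : ℝ => v) (M.F i).law)
include hmean

theorem integrable_pay (a : ICMechanism n) (i : Fin n) :
    Integrable (fun v => a.pay v i) M.valueLaw := by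
  refine Integrable.mono' (M.integrable_comp_eval i (hmean i))
    (a.measurable_pay_apply i).aestronglyMeasurable ?_
  filter_upwards [M.ae_nonneg] with v hv
  rw [Real.norm_of_nonneg (a.pay_nonneg v hv i)]
  exact (a.rational v hv i).trans (mul_le_of_le_one_right (hv i) (a.alloc_le_one hv i))

theorem integrable_virtualValue (i : Fin n) :
    Integrable (fun v : Fin n → ℝ => (M.F i).realVirtualValue (v i)) M.valueLaw :=
  M.integrable_comp_eval i ((M.F i).integrable_realVirtualValue (hmean i))

omit hmean in
theorem integrable_alloc_mul (a : ICMechanism n) (i : Fin n) {g : (Fin n → ℝ) → ℝ}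
    (hg : Integrable g M.valueLaw) : Integrable (fun v => a.alloc v i * g v) M.valueLaw := by
  refine hg.bdd_mul (c := 1) (a.measurable_alloc_apply i).aestronglyMeasurable ?_
  filter_upwards [M.ae_nonneg] with v hv
  rw [Real.norm_of_nonneg (a.alloc_nonneg v hv i)]
  exact a.alloc_le_one hv i

omit hmean in
theorem integral_pay_update_eq (a : ICMechanism n) (i : Fin n) {v : Fin n → ℝ} (hv : 0 ≤ v) :
    ∫ b, a.pay (Function.update v i b) i ∂(M.F i).law =
      ∫ b, (b * a.alloc (Function.update v i b) i -
        ∫ s in (0 : ℝ)..b, a.alloc (Function.update v i s) i) ∂(M.F i).law := by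
  refine integral_congr_ae ?_
  filter_upwards [(M.F i).ae_nonneg] with b hb using a.pay_update_eq hv i hb

theorem integral_pay_le (a : ICMechanism n) (i : Fin n) :
    ∫ v, a.pay v i ∂M.valueLaw ≤
      ∫ v, a.alloc v i * (M.F i).realVirtualValue (v i) ∂M.valueLaw := by
  obtain ⟨h1, h2⟩ := M.integral_eq_integral_update i (M.integrable_pay hmean a i)
  obtain ⟨h3, h4⟩ := M.integral_eq_integral_update i
    (M.integrable_alloc_mul a i (M.integrable_virtualValue hmean i))
  rw [h2, h4]
  refine integral_mono_ae h1 h3 ?_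
  filter_upwards [M.ae_nonneg] with v hv
  have hu : ∀ s, 0 ≤ s → 0 ≤ Function.update v i s := fun s => ICMechanism.update_nonneg hv i
  simp only [Function.update_self]
  rw [M.integral_pay_update_eq a i hv]
  exact (M.F i).integral_pay_le (hmean i)
    ((a.measurable_alloc_apply i).comp (measurable_update v))
    (fun s hs => a.alloc_nonneg _ (hu s hs) i) (fun s hs => a.alloc_le_one (hu s hs) i)
    (a.monotoneOn_alloc hv i)

theorem integral_pay_eq (a : ICMechanism n) (i : Fin n)
    (hz : ∀ v, 0 ≤ v → (M.F i).pdf (v i) = 0 → cdf (M.F i).law (v i) < 1 → a.alloc v i = 0) :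
    ∫ v, a.pay v i ∂M.valueLaw =
      ∫ v, a.alloc v i * (M.F i).realVirtualValue (v i) ∂M.valueLaw := by
  obtain ⟨h1, h2⟩ := M.integral_eq_integral_update i (M.integrable_pay hmean a i)
  obtain ⟨h3, h4⟩ := M.integral_eq_integral_update i
    (M.integrable_alloc_mul a i (M.integrable_virtualValue hmean i))
  rw [h2, h4]
  refine integral_congr_ae ?_
  filter_upwards [M.ae_nonneg] with v hv
  have hu : ∀ s, 0 ≤ s → 0 ≤ Function.update v i s := fun s => ICMechanism.update_nonneg hv i
  simp only [Function.update_self]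
  rw [M.integral_pay_update_eq a i hv]
  refine (M.F i).integral_pay_eq (hmean i)
    ((a.measurable_alloc_apply i).comp (measurable_update v))
    (fun s hs => a.alloc_nonneg _ (hu s hs) i) (fun s hs => a.alloc_le_one (hu s hs) i)
    (a.monotoneOn_alloc hv i) fun s hs h0 h1 => hz _ (hu s hs) ?_ ?_ <;> simpa

end FiniteMean

/-! ### The one-period problem: scores and the Bellman bound. -/

/-- The continuation values are bounded measurable functions. -/
structure IsBddMeas (W : UserState → ℝ) : Prop where
  meas : Measurable W
  bdd : ∃ C, ∀ c, |W c| ≤ C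

theorem IsBddMeas.integrable {W : UserState → ℝ} (hW : IsBddMeas W) (μ : Measure UserState)
    [IsFiniteMeasure μ] : Integrable W μ := by
  obtain ⟨C, hC⟩ := hW.bdd
  exact Integrable.mono' (integrable_const C) hW.meas.aestronglyMeasurable
    (Filter.Eventually.of_forall hC)

/-- The expected contribution, given the values `v`, of showing ad `i` (`some i`) or no ad
(`none`) in state `c` when the continuation value is `W`. -/
def score (W : UserState → ℝ) (c : UserState) (v : Fin n → ℝ) : Option (Fin n) → ℝ
  | none => M.γ * ∫ c', W c' ∂(M.P ∅ c)
  | some i => (c : ℝ) * (M.F i).realVirtualValue (v i) + M.γ * ∫ c', W c' ∂(M.P {i} c)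

/-- The Bellman operator of the problem, with the single-state optimization solved. -/
def bellman (W : UserState → ℝ) (c : UserState) : ℝ :=
  ∫ v, ⨆ o, M.score W c v o ∂M.valueLaw

/-- The average of the scores over the allocation of a mechanism. -/
def allocScore (W : UserState → ℝ) (c : UserState) (a : ICMechanism n) (v : Fin n → ℝ) : ℝ :=
  ∑ i, a.alloc v i * M.score W c v (some i) + (1 - ∑ i, a.alloc v i) * M.score W c v none

/-- The value of using the mechanism `a` for one period with continuation value `W`. -/
def qValue (W : UserState → ℝ) (c : UserState) (a : ICMechanism n) : ℝ :=
  M.reward a c + M.γ * ∫ c', W c' ∂(M.transition a c)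

theorem score_le_iSup (W : UserState → ℝ) (c : UserState) (v : Fin n → ℝ) (o : Option (Fin n)) :
    M.score W c v o ≤ ⨆ o, M.score W c v o :=
  le_ciSup (Set.finite_range _).bddAbove o

/-- The allocation probabilities and the probability of showing no ad add up to one, so the gap to
the maximum is a weighted sum of the individual gaps. For `0 ≤ v` all weights and gaps are
nonnegative, which yields both the bound and its equality case. -/
theorem iSup_sub_allocScore (W : UserState → ℝ) (c : UserState) (a : ICMechanism n)
    (v : Fin n → ℝ) :
    (⨆ o, M.score W c v o) - M.allocScore W c a v =
      ∑ i, a.alloc v i * ((⨆ o, M.score W c v o) - M.score W c v (some i)) +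
        (1 - ∑ i, a.alloc v i) * ((⨆ o, M.score W c v o) - M.score W c v none) := by
  simp only [allocScore, mul_sub, Finset.sum_sub_distrib, ← Finset.sum_mul]
  ring

theorem allocScore_le (W : UserState → ℝ) (c : UserState) (a : ICMechanism n)
    {v : Fin n → ℝ} (hv : 0 ≤ v) : M.allocScore W c a v ≤ ⨆ o, M.score W c v o := by
  rw [← sub_nonneg, iSup_sub_allocScore]
  exact add_nonneg (Finset.sum_nonneg fun i _ => mul_nonneg (a.alloc_nonneg v hv i)
      (sub_nonneg.mpr (M.score_le_iSup W c v _)))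
    (mul_nonneg (sub_nonneg.mpr (a.sum_alloc_le_one v hv))
      (sub_nonneg.mpr (M.score_le_iSup W c v _)))

theorem allocScore_eq_iff (W : UserState → ℝ) (c : UserState) (a : ICMechanism n)
    {v : Fin n → ℝ} (hv : 0 ≤ v) : M.allocScore W c a v = ⨆ o, M.score W c v o ↔
      (∀ i, a.alloc v i ≠ 0 → M.score W c v (some i) = ⨆ o, M.score W c v o) ∧
      (∑ i, a.alloc v i ≠ 1 → M.score W c v none = ⨆ o, M.score W c v o) := by
  have hs : ∀ i ∈ Finset.univ,
      0 ≤ a.alloc v i * ((⨆ o, M.score W c v o) - M.score W c v (some i)) :=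
    fun i _ => mul_nonneg (a.alloc_nonneg v hv i) (sub_nonneg.mpr (M.score_le_iSup W c v _))
  rw [eq_comm, ← sub_eq_zero, iSup_sub_allocScore, add_eq_zero_iff_of_nonneg
    (Finset.sum_nonneg hs) (mul_nonneg (sub_nonneg.mpr (a.sum_alloc_le_one v hv))
      (sub_nonneg.mpr (M.score_le_iSup W c v _))), Finset.sum_eq_zero_iff_of_nonneg hs]
  simp only [Finset.mem_univ, true_implies, mul_eq_zero, sub_eq_zero]
  refine and_congr (forall_congr' fun i => ?_) ?_
  · rw [or_iff_not_imp_left, eq_comm (a := iSup _)]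
  · rw [or_iff_not_imp_left, eq_comm (a := iSup _), eq_comm (a := (1 : ℝ))]

theorem integral_transition {W : UserState → ℝ} (hW : IsBddMeas W) (a : ICMechanism n)
    (c : UserState) :
    ∫ c', W c' ∂(M.transition a c) = ∑ i, M.winProb a i * ∫ c', W c' ∂(M.P {i} c) +
      (1 - ∑ i, M.winProb a i) * ∫ c', W c' ∂(M.P ∅ c) := by
  have hi : ∀ (r : ℝ) (S : Finset (Fin n)), Integrable W (ENNReal.ofReal r • M.P S c) :=
    fun r S => (hW.integrable _).smul_measure ENNReal.ofReal_ne_top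
  rw [transition, integral_add_measure (integrable_finsetSum_measure.mpr fun i _ => hi _ _)
    (hi _ _), integral_finsetSum_measure fun i _ => hi _ _]
  simp [integral_smul_measure, ENNReal.toReal_ofReal, M.winProb_nonneg,
    sub_nonneg.mpr (M.sum_winProb_le_one a)]

section FiniteMean

variable (hmean : ∀ i, Integrable (fun v : ℝ => v) (M.F i).law)
include hmean

theorem integrable_score (W : UserState → ℝ) (c : UserState) (o : Option (Fin n)) :
    Integrable (fun v => M.score W c v o) M.valueLaw := by
  cases o with
  | none => exact integrable_const _
  | some i => exact ((M.integrable_virtualValue hmean i).const_mul _).add (integrable_const _)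

theorem integrable_iSup_score (W : UserState → ℝ) (c : UserState) :
    Integrable (fun v => ⨆ o, M.score W c v o) M.valueLaw := by
  refine Integrable.mono' (integrable_finsetSum Finset.univ
    fun o _ => (M.integrable_score hmean W c o).norm) ?_ (Filter.Eventually.of_forall fun v => ?_)
  · refine (AEMeasurable.iSup fun o => ?_).aestronglyMeasurable
    exact (M.integrable_score hmean W c o).aemeasurable
  · obtain ⟨o, ho⟩ := exists_eq_ciSup_of_finite (f := M.score W c v)
    rw [← ho]
    exact Finset.single_le_sum (f := fun o => ‖M.score W c v o‖)
      (fun _ _ => norm_nonneg _) (Finset.mem_univ o)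

theorem integrable_allocScore (W : UserState → ℝ) (c : UserState) (a : ICMechanism n) :
    Integrable (M.allocScore W c a) M.valueLaw :=
  (integrable_finsetSum _ fun i _ =>
    M.integrable_alloc_mul a i (M.integrable_score hmean W c (some i))).add
    (((integrable_const _).sub (integrable_finsetSum _ fun i _ => M.integrable_alloc a i)).mul_const
      _)

theorem integral_allocScore {W : UserState → ℝ} (hW : IsBddMeas W) (c : UserState)
    (a : ICMechanism n) :
    ∫ v, M.allocScore W c a v ∂M.valueLaw =
      (c : ℝ) * ∑ i, ∫ v, a.alloc v i * (M.F i).realVirtualValue (v i) ∂M.valueLaw +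
        M.γ * ∫ c', W c' ∂(M.transition a c) := by
  have h1 := fun i => M.integrable_alloc_mul a i (M.integrable_score hmean W c (some i))
  have hs := integrable_finsetSum Finset.univ fun i _ => M.integrable_alloc a i
  have hn : Integrable (fun v => (1 - ∑ i, a.alloc v i) * (M.γ * ∫ c', W c' ∂(M.P ∅ c)))
      M.valueLaw := ((integrable_const _).sub hs).mul_const _
  change ∫ v, (∑ i, a.alloc v i * M.score W c v (some i) +
    (1 - ∑ i, a.alloc v i) * (M.γ * ∫ c', W c' ∂(M.P ∅ c))) ∂M.valueLaw = _
  rw [integral_add (integrable_finsetSum _ fun i _ => h1 i) hn,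
    integral_finsetSum _ fun i _ => h1 i, integral_mul_const, integral_sub (integrable_const _) hs,
    integral_finsetSum _ fun i _ => M.integrable_alloc a i, M.integral_transition hW]
  have h2 : ∀ i, ∫ v, a.alloc v i * M.score W c v (some i) ∂M.valueLaw =
      c * ∫ v, a.alloc v i * (M.F i).realVirtualValue (v i) ∂M.valueLaw +
        M.γ * (M.winProb a i * ∫ c', W c' ∂(M.P {i} c)) := by
    intro i
    rw [winProb, ← integral_const_mul, ← integral_mul_const, ← integral_const_mul,
      ← integral_add ((M.integrable_alloc_mul a i (M.integrable_virtualValue hmean i)).const_mul _)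
        (((M.integrable_alloc a i).mul_const _).const_mul _)]
    refine integral_congr_ae (Filter.Eventually.of_forall fun v => ?_)
    simp only [score]; ring
  simp only [h2, Finset.sum_add_distrib, ← Finset.mul_sum, winProb, integral_const,
    probReal_univ, one_smul]
  ring

theorem reward_eq (a : ICMechanism n) (c : UserState) :
    M.reward a c = c * ∑ i, ∫ v, a.pay v i ∂M.valueLaw := by
  rw [reward, integral_finsetSum _ fun i _ => M.integrable_pay hmean a i]

theorem qValue_le_integral_allocScore {W : UserState → ℝ} (hW : IsBddMeas W) (c : UserState)
    (a : ICMechanism n) : M.qValue W c a ≤ ∫ v, M.allocScore W c a v ∂M.valueLaw := by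
  rw [M.integral_allocScore hmean hW, qValue, M.reward_eq hmean]
  exact add_le_add_left (mul_le_mul_of_nonneg_left
    (Finset.sum_le_sum fun i _ => M.integral_pay_le hmean a i) c.2.1) _

theorem integral_allocScore_le_bellman (W : UserState → ℝ) (c : UserState)
    (a : ICMechanism n) : ∫ v, M.allocScore W c a v ∂M.valueLaw ≤ M.bellman W c := by
  refine integral_mono_ae (M.integrable_allocScore hmean W c a)
    (M.integrable_iSup_score hmean W c) ?_
  filter_upwards [M.ae_nonneg] with v hv using M.allocScore_le W c a hv

theorem qValue_le_bellman {W : UserState → ℝ} (hW : IsBddMeas W) (c : UserState)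
    (a : ICMechanism n) : M.qValue W c a ≤ M.bellman W c :=
  (M.qValue_le_integral_allocScore hmean hW c a).trans
    (M.integral_allocScore_le_bellman hmean W c a)

/-- Equality at the two ends of `qValue ≤ ∫ allocScore ≤ bellman` gives equality of the integrals of
two functions that are ordered almost everywhere, so these agree almost everywhere. -/
theorem ae_allocScore_eq_of_qValue_eq {W : UserState → ℝ} (hW : IsBddMeas W) {c : UserState}
    {a : ICMechanism n} (h : M.qValue W c a = M.bellman W c) :
    ∀ᵐ v ∂M.valueLaw, M.allocScore W c a v = ⨆ o, M.score W c v o := by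
  have h1 : ∫ v, M.allocScore W c a v ∂M.valueLaw = M.bellman W c :=
    le_antisymm (M.integral_allocScore_le_bellman hmean W c a)
      (h ▸ M.qValue_le_integral_allocScore hmean hW c a)
  refine (integral_eq_iff_of_ae_le (M.integrable_allocScore hmean W c a)
    (M.integrable_iSup_score hmean W c) ?_).mp h1
  filter_upwards [M.ae_nonneg] with v hv using M.allocScore_le W c a hv

/-- Avoiding the values with `φ_i = -∞` is demanded only for `c ≠ 0`: in state zero revenue is
multiplied by zero and the Myerson loss costs nothing. -/
theorem qValue_eq_bellman {W : UserState → ℝ} (hW : IsBddMeas W) {c : UserState}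
    {a : ICMechanism n}
    (hz : (c : ℝ) ≠ 0 → ∀ i v, 0 ≤ v → (M.F i).pdf (v i) = 0 → cdf (M.F i).law (v i) < 1 →
      a.alloc v i = 0)
    (h : ∀ᵐ v ∂M.valueLaw, M.allocScore W c a v = ⨆ o, M.score W c v o) :
    M.qValue W c a = M.bellman W c := by
  rw [bellman, ← integral_congr_ae h, M.integral_allocScore hmean hW, qValue, M.reward_eq hmean]
  rcases eq_or_ne (c : ℝ) 0 with h0 | h0
  · simp [h0]
  · congr 2
    exact Finset.sum_congr rfl fun i _ => M.integral_pay_eq hmean a i (hz h0 i)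

end FiniteMean

end AdMDP

/-! ### The Bellman operator is a contraction and has a fixed point. -/

theorem abs_ciSup_sub_ciSup_le {ι : Type*} [Finite ι] [Nonempty ι] {f g : ι → ℝ} {δ : ℝ}
    (h : ∀ i, |f i - g i| ≤ δ) : |(⨆ i, f i) - ⨆ i, g i| ≤ δ := by
  have key : ∀ {f g : ι → ℝ}, (∀ i, |f i - g i| ≤ δ) → (⨆ i, f i) - (⨆ i, g i) ≤ δ := by
    intro f g h
    rw [sub_le_iff_le_add]
    refine ciSup_le fun i => ?_
    have h1 := le_ciSup (Set.finite_range g).bddAbove i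
    have h2 := (abs_le.mp (h i)).2
    linarith
  rw [abs_le]
  have h1 := key h
  have h2 := key fun i => (abs_sub_comm (g i) (f i)).trans_le (h i)
  constructor <;> linarith

namespace AdMDP

variable {n : ℕ} (M : AdMDP n)

theorem abs_integral_sub_le {W W' : UserState → ℝ} (hW : IsBddMeas W) (hW' : IsBddMeas W')
    {δ : ℝ} (h : ∀ c, |W c - W' c| ≤ δ) (μ : Measure UserState) [IsProbabilityMeasure μ] :
    |∫ c, W c ∂μ - ∫ c, W' c ∂μ| ≤ δ := by
  rw [← integral_sub (hW.integrable μ) (hW'.integrable μ)]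
  simpa using norm_integral_le_of_norm_le_const (μ := μ) (f := fun c => W c - W' c)
    (Filter.Eventually.of_forall h)

theorem abs_score_sub_le {W W' : UserState → ℝ} (hW : IsBddMeas W) (hW' : IsBddMeas W')
    {δ : ℝ} (h : ∀ c, |W c - W' c| ≤ δ) (c : UserState) (v : Fin n → ℝ) (o : Option (Fin n)) :
    |M.score W c v o - M.score W' c v o| ≤ M.γ * δ := by
  have key : ∀ S, |M.γ * ∫ c', W c' ∂(M.P S c) - M.γ * ∫ c', W' c' ∂(M.P S c)| ≤ M.γ * δ := by
    intro S
    rw [← mul_sub, abs_mul, abs_of_nonneg M.γ_nonneg]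
    exact mul_le_mul_of_nonneg_left (abs_integral_sub_le hW hW' h _) M.γ_nonneg
  cases o with
  | none => exact key ∅
  | some i =>
    simp only [score, add_sub_add_left_eq_sub]
    exact key {i}

theorem measurable_integral_P {W : UserState → ℝ} (hW : IsBddMeas W) (S : Finset (Fin n)) :
    Measurable fun c => ∫ c', W c' ∂(M.P S c) :=
  (hW.meas.stronglyMeasurable.integral_kernel (κ := M.P S)).measurable

theorem measurable_score {W : UserState → ℝ} (hW : IsBddMeas W) (o : Option (Fin n)) :
    Measurable fun q : UserState × (Fin n → ℝ) => M.score W q.1 q.2 o := by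
  cases o with
  | none => exact ((M.measurable_integral_P hW ∅).const_mul _).comp measurable_fst
  | some i =>
    exact ((measurable_subtype_coe.comp measurable_fst).mul
      ((M.F i).measurable_realVirtualValue.comp ((measurable_pi_apply i).comp measurable_snd))).add
      (((M.measurable_integral_P hW {i}).const_mul _).comp measurable_fst)

theorem measurable_bellman {W : UserState → ℝ} (hW : IsBddMeas W) :
    Measurable (M.bellman W) := by
  refine (StronglyMeasurable.integral_prod_right'
    (f := fun q : UserState × (Fin n → ℝ) => ⨆ o, M.score W q.1 q.2 o) ?_).measurable
  exact (Measurable.iSup (M.measurable_score hW)).stronglyMeasurable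

section FiniteMean

variable (hmean : ∀ i, Integrable (fun v : ℝ => v) (M.F i).law)
include hmean

/-- The virtual value terms of the scores do not involve `W`, so the scores move by at most `γ * δ`;
maxima and expectations do not increase this distance. -/
theorem abs_bellman_sub_le {W W' : UserState → ℝ} (hW : IsBddMeas W) (hW' : IsBddMeas W')
    {δ : ℝ} (h : ∀ c, |W c - W' c| ≤ δ) (c : UserState) :
    |M.bellman W c - M.bellman W' c| ≤ M.γ * δ := by
  rw [bellman, bellman, ← integral_sub (M.integrable_iSup_score hmean W c)
    (M.integrable_iSup_score hmean W' c)]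
  simpa using norm_integral_le_of_norm_le_const (μ := M.valueLaw)
    (f := fun v => (⨆ o, M.score W c v o) - ⨆ o, M.score W' c v o)
    (Filter.Eventually.of_forall fun v =>
      abs_ciSup_sub_ciSup_le fun o => M.abs_score_sub_le hW hW' h c v o)

theorem abs_bellman_zero_le (c : UserState) :
    |M.bellman 0 c| ≤ ∑ i, ∫ v, |(M.F i).realVirtualValue (v i)| ∂M.valueLaw := by
  rw [← integral_finsetSum _ fun i _ => (M.integrable_virtualValue hmean i).abs]
  rw [bellman, ← Real.norm_eq_abs]
  refine norm_integral_le_of_norm_le (integrable_finsetSum _ fun i _ =>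
    (M.integrable_virtualValue hmean i).abs) (Filter.Eventually.of_forall fun v => ?_)
  obtain ⟨o, ho⟩ := exists_eq_ciSup_of_finite (f := M.score 0 c v)
  rw [← ho]
  cases o with
  | none => simpa [score] using Finset.sum_nonneg fun i _ => abs_nonneg _
  | some i =>
    refine le_trans ?_ (Finset.single_le_sum
      (f := fun i => |(M.F i).realVirtualValue (v i)|) (fun _ _ => abs_nonneg _)
      (Finset.mem_univ i))
    simp only [score, Pi.zero_apply, integral_zero, mul_zero, add_zero, Real.norm_eq_abs, abs_mul,
      abs_of_nonneg c.2.1]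
    exact mul_le_of_le_one_left (abs_nonneg _) c.2.2

omit hmean in
theorem isBddMeas_zero : IsBddMeas 0 := ⟨measurable_const, 0, by simp⟩

theorem isBddMeas_bellman {W : UserState → ℝ} (hW : IsBddMeas W) : IsBddMeas (M.bellman W) := by
  obtain ⟨C, hC⟩ := hW.bdd
  refine ⟨M.measurable_bellman hW,
    M.γ * C + ∑ i, ∫ v, |(M.F i).realVirtualValue (v i)| ∂M.valueLaw, fun c => ?_⟩
  have h1 := M.abs_bellman_sub_le hmean hW isBddMeas_zero (δ := C) (by simpa using hC) c
  have h2 := M.abs_bellman_zero_le hmean c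
  have h3 := abs_sub_abs_le_abs_sub (M.bellman W c) (M.bellman 0 c)
  linarith

/-- The Bellman operator has a bounded measurable fixed point. -/
theorem exists_bellman_eq : ∃ W, IsBddMeas W ∧ ∀ c, M.bellman W c = W c := by
  set B := ∑ i, ∫ v, |(M.F i).realVirtualValue (v i)| ∂M.valueLaw
  set u : ℕ → UserState → ℝ := fun k => M.bellman^[k] 0 with hu
  have hsucc : ∀ k, u (k + 1) = M.bellman (u k) := fun k => Function.iterate_succ_apply' _ _ _
  have hm : ∀ k, IsBddMeas (u k) := by
    intro k
    induction k with
    | zero => exact isBddMeas_zero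
    | succ k ih => rw [hsucc]; exact M.isBddMeas_bellman hmean ih
  -- Value iteration from zero has geometrically decreasing steps. The limit is taken pointwise, so
  -- that measurability passes to it.
  have hstep : ∀ k c, |u k c - u (k + 1) c| ≤ B * M.γ ^ k := by
    intro k
    induction k with
    | zero =>
      intro c
      simpa [hu] using M.abs_bellman_zero_le hmean c
    | succ k ih =>
      intro c
      rw [hsucc k, hsucc (k + 1)]
      refine (M.abs_bellman_sub_le hmean (hm k) (hm (k + 1)) ih c).trans_eq ?_
      ring
  have hlim : ∀ c, ∃ w, Filter.Tendsto (fun k => u k c) Filter.atTop (nhds w) := fun c =>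
    cauchySeq_tendsto_of_complete
      (cauchySeq_of_le_geometric M.γ B M.γ_lt_one fun k => hstep k c)
  choose W hW using hlim
  have hdist : ∀ k c, |u k c - W c| ≤ B * M.γ ^ k / (1 - M.γ) := fun k c =>
    dist_le_of_le_geometric_of_tendsto M.γ B M.γ_lt_one (fun k => hstep k c) (hW c) k
  have hWm : IsBddMeas W := by
    refine ⟨measurable_of_tendsto_metrizable (fun k => (hm k).meas) (tendsto_pi_nhds.mpr hW),
      B * M.γ ^ 0 / (1 - M.γ), fun c => ?_⟩
    simpa [hu] using hdist 0 c
  refine ⟨W, hWm, fun c => ?_⟩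
  -- The shifted iterates `bellman (u k)` converge to `bellman W` by contraction and to `W` as a
  -- shifted sequence.
  refine tendsto_nhds_unique (f := fun k => u (k + 1) c) ?_
    ((hW c).comp (Filter.tendsto_add_atTop_nat 1))
  rw [tendsto_iff_dist_tendsto_zero]
  have hz : Filter.Tendsto (fun k => M.γ * (B * M.γ ^ k / (1 - M.γ))) Filter.atTop (nhds 0) := by
    have := (((tendsto_pow_atTop_nhds_zero_of_lt_one M.γ_nonneg M.γ_lt_one).const_mul B).div_const
      (1 - M.γ)).const_mul M.γ
    simpa using this
  refine squeeze_zero (fun _ => dist_nonneg) (fun k => ?_) hz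
  rw [hsucc]
  exact M.abs_bellman_sub_le hmean (hm k) hWm (hdist k) c

end FiniteMean

end AdMDP

/-! ### Values of policies along trajectories. -/

namespace AdMDP

variable {n : ℕ} (M : AdMDP n)

instance (π : Policy n) (c : UserState) : IsProbabilityMeasure (M.trajLaw π c) := by
  unfold trajLaw; infer_instance

theorem IsBddMeas.integrable_trajLaw {g : UserState → ℝ} (hg : IsBddMeas g) (π : Policy n)
    (c : UserState) (t : ℕ) : Integrable (fun s => g (s t)) (M.trajLaw π c) := by
  obtain ⟨C, hC⟩ := hg.bdd
  exact Integrable.mono' (integrable_const C)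
    (hg.meas.comp (measurable_pi_apply t)).aestronglyMeasurable
    (Filter.Eventually.of_forall fun s => hC (s t))

theorem integral_trajLaw_zero {g : UserState → ℝ} (hg : IsBddMeas g) (π : Policy n)
    (c : UserState) : ∫ s, g (s 0) ∂(M.trajLaw π c) = g c := by
  rw [trajLaw, Kernel.integral_traj]
  · simp [Function.updateFinset]
  · exact (hg.integrable_trajLaw M π c 0).aestronglyMeasurable

/-- Markov property: the history up to `t` together with the next state has the law of the partial
trajectory followed by one step of the kernel, and that kernel depends only on the last state of the
history. -/
theorem integral_trajLaw_succ {g : UserState → ℝ} (hg : IsBddMeas g) (π : Policy n)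
    (c : UserState) (t : ℕ) :
    ∫ s, g (s (t + 1)) ∂(M.trajLaw π c) =
      ∫ s, ∫ c', g c' ∂(M.stepKernel π (s t)) ∂(M.trajLaw π c) := by
  set κ : (t : ℕ) → Kernel (Π _ : Finset.Iic t, UserState) UserState := fun t =>
    (M.stepKernel π).comap
      (fun h : (Π _ : Finset.Iic t, UserState) => h ⟨t, Finset.mem_Iic.mpr le_rfl⟩)
      (measurable_pi_apply _) with hκ
  have hmk : ∀ t, IsMarkovKernel (κ t) := fun t => by rw [hκ]; infer_instance
  have hmap := Kernel.partialTraj_compProd_eq_map_traj (X := fun _ => UserState) (κ := κ)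
    (Nat.zero_le t) (x₀ := fun _ => c)
  have h1 : ∫ s, g (s (t + 1)) ∂(M.trajLaw π c) =
      ∫ q, g q.2 ∂((Kernel.traj (X := fun _ => UserState) κ 0 (fun _ => c)).map
        (fun x => (Preorder.frestrictLe t x, x (t + 1)))) := by
    exact (integral_map (f := fun q : (Π _ : Finset.Iic t, UserState) × UserState => g q.2)
      (φ := fun x : ℕ → UserState =>
        (Preorder.frestrictLe (π := fun _ => UserState) t x, x (t + 1)))
      (by fun_prop) (hg.meas.comp measurable_snd).aestronglyMeasurable).symm
  have hint : Integrable (fun q : (Π _ : Finset.Iic t, UserState) × UserState => g q.2)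
      ((Kernel.partialTraj (X := fun _ => UserState) κ 0 t (fun _ => c)) ⊗ₘ (κ t)) := by
    obtain ⟨C, hC⟩ := hg.bdd
    exact Integrable.mono' (integrable_const C)
      (hg.meas.comp measurable_snd).aestronglyMeasurable
      (Filter.Eventually.of_forall fun s => hC s.2)
  have hK : Measurable fun c => ∫ c', g c' ∂(M.stepKernel π c) :=
    (hg.meas.stronglyMeasurable.integral_kernel (κ := M.stepKernel π)).measurable
  rw [h1, ← hmap, Measure.integral_compProd hint,
    ← Kernel.traj_map_frestrictLe_apply, integral_map (by fun_prop)]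
  · rfl
  · exact (hK.comp (measurable_pi_apply (⟨t, Finset.mem_Iic.mpr le_rfl⟩ : Finset.Iic t)))
      |>.aestronglyMeasurable

section FiniteMean

variable (hmean : ∀ i, Integrable (fun v : ℝ => v) (M.F i).law)
include hmean

theorem isBddMeas_reward (π : Policy n) : IsBddMeas fun c => M.reward (π.mech c) c := by
  -- By individual rationality no bidder pays more than the value, and `ctr ≤ 1`, so the sum of the
  -- means bounds the reward.
  refine ⟨?_, ∑ i, ∫ v, v ∂(M.F i).law, fun c => ?_⟩
  · refine measurable_subtype_coe.mul (StronglyMeasurable.integral_prod_right'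
      (f := fun q : UserState × (Fin n → ℝ) => ∑ i, (π.mech q.1).pay q.2 i) ?_).measurable
    exact (Finset.measurable_fun_sum _ fun i _ =>
      (measurable_pi_apply i).comp π.measurable_pay).stronglyMeasurable
  · have h0 : ∀ i, 0 ≤ ∫ v, (π.mech c).pay v i ∂M.valueLaw := fun i => by
      refine integral_nonneg_of_ae ?_
      filter_upwards [M.ae_nonneg] with v hv using (π.mech c).pay_nonneg v hv i
    have h1 : 0 ≤ ∑ i, ∫ v, (π.mech c).pay v i ∂M.valueLaw := Finset.sum_nonneg fun i _ => h0 i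
    rw [M.reward_eq hmean, abs_of_nonneg (mul_nonneg c.2.1 h1)]
    refine (mul_le_of_le_one_left h1 c.2.2).trans (Finset.sum_le_sum fun i _ => ?_)
    rw [← M.integral_comp_eval i (hmean i)]
    refine integral_mono_ae (M.integrable_pay hmean _ i) (M.integrable_comp_eval i (hmean i)) ?_
    filter_upwards [M.ae_nonneg] with v hv
    exact ((π.mech c).rational v hv i).trans
      (mul_le_of_le_one_right (hv i) ((π.mech c).alloc_le_one hv i))

theorem hasSum_value (π : Policy n) (c : UserState) :
    HasSum (fun t : ℕ => M.γ ^ t * ∫ s, M.reward (π.mech (s t)) (s t) ∂(M.trajLaw π c))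
      (M.value π c) := by
  have hR := M.isBddMeas_reward hmean π
  obtain ⟨C, hC⟩ := hR.bdd
  have := hasSum_integral_of_summable_integral_norm (μ := M.trajLaw π c)
    (F := fun (t : ℕ) s => M.γ ^ t * M.reward (π.mech (s t)) (s t))
    (fun t => (hR.integrable_trajLaw M π c t).const_mul _) ?_
  · simpa only [integral_const_mul, value] using this
  · refine Summable.of_nonneg_of_le (fun t => integral_nonneg fun _ => norm_nonneg _)
      (fun t => ?_) ((summable_geometric_of_lt_one M.γ_nonneg M.γ_lt_one).mul_right C)
    refine (integral_mono ((hR.integrable_trajLaw M π c t).const_mul _).norm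
      (integrable_const (M.γ ^ t * C)) fun s => ?_).trans_eq (by simp)
    rw [norm_mul, Real.norm_of_nonneg (pow_nonneg M.γ_nonneg t)]
    exact mul_le_mul_of_nonneg_left (hC (s t)) (pow_nonneg M.γ_nonneg t)

theorem isBddMeas_qValue {W : UserState → ℝ} (hW : IsBddMeas W) (π : Policy n) :
    IsBddMeas fun c => M.qValue W c (π.mech c) := by
  have hR := M.isBddMeas_reward hmean π
  obtain ⟨C, hC⟩ := hR.bdd
  obtain ⟨D, hD⟩ := hW.bdd
  refine ⟨hR.meas.add ((hW.meas.stronglyMeasurable.integral_kernel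
    (κ := M.stepKernel π)).measurable.const_mul _), C + M.γ * D, fun c => ?_⟩
  refine (abs_add_le _ _).trans (add_le_add (hC c) ?_)
  rw [abs_mul, abs_of_nonneg M.γ_nonneg]
  refine mul_le_mul_of_nonneg_left ?_ M.γ_nonneg
  have := M.isProbabilityMeasure_transition (π.mech c) c
  simpa using norm_integral_le_of_norm_le_const (μ := M.transition (π.mech c) c) (f := W)
    (Filter.Eventually.of_forall hD)

/-- The value of a policy, compared with a candidate value function `W`. -/
theorem hasSum_value_sub_qValue {W : UserState → ℝ} (hW : IsBddMeas W) (π : Policy n)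
    (c : UserState) :
    HasSum (fun t : ℕ => M.γ ^ (t + 1) *
      ∫ s, (M.qValue W (s (t + 1)) (π.mech (s (t + 1))) - W (s (t + 1))) ∂(M.trajLaw π c))
      (M.value π c - M.qValue W c (π.mech c)) := by
  have hR := M.isBddMeas_reward hmean π
  have hQ := M.isBddMeas_qValue hmean hW π
  set m : ℕ → ℝ := fun t => ∫ s, W (s t) ∂(M.trajLaw π c)
  set q : ℕ → ℝ := fun t => ∫ s, M.qValue W (s t) (π.mech (s t)) ∂(M.trajLaw π c)
  set r : ℕ → ℝ := fun t => ∫ s, M.reward (π.mech (s t)) (s t) ∂(M.trajLaw π c)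
  have hq0 : q 0 = M.qValue W c (π.mech c) := M.integral_trajLaw_zero hQ π c
  have hK : IsBddMeas fun c => ∫ c', W c' ∂(M.stepKernel π c) := by
    obtain ⟨D, hD⟩ := hW.bdd
    refine ⟨(hW.meas.stronglyMeasurable.integral_kernel (κ := M.stepKernel π)).measurable, D,
      fun c => ?_⟩
    simpa using norm_integral_le_of_norm_le_const (μ := M.stepKernel π c) (f := W)
      (Filter.Eventually.of_forall hD)
  -- Taking expectations in the definition of `qValue` at time `t`, with the Markov property for the
  -- continuation term.
  have hq : ∀ t, q t = r t + M.γ * m (t + 1) := by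
    intro t
    simp only [q, r, m, M.integral_trajLaw_succ hW]
    rw [← integral_const_mul, ← integral_add (hR.integrable_trajLaw M π c t)
      ((hK.integrable_trajLaw M π c t).const_mul _)]
    rfl
  have hm : Summable fun t => M.γ ^ t * m t := by
    obtain ⟨D, hD⟩ := hW.bdd
    refine Summable.of_norm_bounded
      ((summable_geometric_of_lt_one M.γ_nonneg M.γ_lt_one).mul_right D) fun t => ?_
    rw [norm_mul, Real.norm_of_nonneg (pow_nonneg M.γ_nonneg t)]
    refine mul_le_mul_of_nonneg_left ?_ (pow_nonneg M.γ_nonneg t)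
    simpa using norm_integral_le_of_norm_le_const (μ := M.trajLaw π c) (f := fun s => W (s t))
      (Filter.Eventually.of_forall fun s => hD (s t))
  have hm1 := (summable_nat_add_iff 1).mpr hm
  have hv := M.hasSum_value hmean π c
  have hsumq : HasSum (fun t => M.γ ^ t * q t)
      (M.value π c + ∑' t, M.γ ^ (t + 1) * m (t + 1)) := by
    refine (hv.add hm1.hasSum).congr_fun fun t => ?_
    simp only [hq]
    ring
  -- The term at time zero is `qValue` at the initial state itself and moves to the other side, so
  -- only the later gaps `qValue - W` remain.
  have hshift := (hasSum_nat_add_iff' 1).mpr hsumq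
  have := hshift.sub hm1.hasSum
  simp only [Finset.range_one, Finset.sum_singleton, pow_zero, one_mul, hq0] at this
  have he : M.value π c + ∑' t, M.γ ^ (t + 1) * m (t + 1) - M.qValue W c (π.mech c) -
      ∑' t, M.γ ^ (t + 1) * m (t + 1) = M.value π c - M.qValue W c (π.mech c) := by ring
  rw [he] at this
  refine this.congr_fun fun t => ?_
  rw [integral_sub (hQ.integrable_trajLaw M π c _) (hW.integrable_trajLaw M π c _)]
  ring

/-- Bounding by `qValue` at the initial state, rather than by `W`, is what later constrains the
mechanism of an optimal policy in every single state. -/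
theorem value_le_qValue {W : UserState → ℝ} (hW : IsBddMeas W) (π : Policy n)
    (h : ∀ c, M.qValue W c (π.mech c) ≤ W c) (c : UserState) :
    M.value π c ≤ M.qValue W c (π.mech c) := by
  rw [← sub_nonpos]
  refine (M.hasSum_value_sub_qValue hmean hW π c).nonpos fun t => ?_
  exact mul_nonpos_of_nonneg_of_nonpos (pow_nonneg M.γ_nonneg _)
    (integral_nonpos fun s => sub_nonpos.mpr (h _))

theorem value_eq_of_qValue_eq {W : UserState → ℝ} (hW : IsBddMeas W) (π : Policy n)
    (h : ∀ c, M.qValue W c (π.mech c) = W c) (c : UserState) : M.value π c = W c := by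
  have := M.hasSum_value_sub_qValue hmean hW π c
  simp only [h, sub_self, integral_zero, mul_zero] at this
  exact sub_eq_zero.mp (this.unique hasSum_zero)

end FiniteMean

end AdMDP

/-! ### The greedy policy and its implementation. -/

namespace ValueDist

variable (F : ValueDist)

/-- For zero density the quotient in `[0, ∞]` is infinite if `F < 1`; if `F = 1` it is `0 / 0 = 0`,
in agreement with real division. -/
theorem virtualValue_eq (v : ℝ) : F.virtualValue v =
    if F.pdf v = 0 ∧ cdf F.law v < 1 then ⊥ else (F.realVirtualValue v : EReal) := by
  have h1 : 0 ≤ 1 - cdf F.law v := sub_nonneg.mpr (cdf_le_one _ _)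
  rcases (F.pdf_nonneg v).eq_or_lt with h | h
  · rcases (cdf_le_one F.law v).lt_or_eq with hc | hc
    · rw [if_pos ⟨h.symm, hc⟩, virtualValue, ← h, ENNReal.ofReal_zero, ENNReal.div_zero]
      · simp
      · simpa using hc
    · simp [virtualValue, realVirtualValue, hc]
  · rw [if_neg fun h' => h.ne' h'.1, virtualValue, ← ENNReal.ofReal_div_of_pos h,
      EReal.coe_ennreal_ofReal, max_eq_left (div_nonneg h1 h.le), realVirtualValue, EReal.coe_sub]

end ValueDist

namespace ICMechanism

variable {n : ℕ}

/-- The payments that make a monotone allocation rule incentive compatible. -/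
def envelopePay (x : (Fin n → ℝ) → Fin n → ℝ) (v : Fin n → ℝ) (i : Fin n) : ℝ :=
  v i * x v i - ∫ s, (Set.Ioc 0 (v i)).indicator (fun s => x (Function.update v i s) i) s

/-- The indicator form has a fixed domain of integration, suited to joint measurability in state and
bids; the interval form serves the incentive estimates. -/
theorem envelopePay_eq (x : (Fin n → ℝ) → Fin n → ℝ) {v : Fin n → ℝ} (hv : 0 ≤ v) (i : Fin n) :
    envelopePay x v i =
      v i * x v i - ∫ s in (0 : ℝ)..(v i), x (Function.update v i s) i := by
  rw [envelopePay, integral_indicator measurableSet_Ioc,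
    intervalIntegral.integral_of_le (show (0 : ℝ) ≤ v i from hv i)]

theorem measurable_envelopePay {α : Type*} [MeasurableSpace α] {x : α → (Fin n → ℝ) → Fin n → ℝ}
    (hx : Measurable fun q : α × (Fin n → ℝ) => x q.1 q.2) :
    Measurable fun q : α × (Fin n → ℝ) => envelopePay (x q.1) q.2 := by
  refine measurable_pi_lambda _ fun i => ?_
  have hv : Measurable fun q : α × (Fin n → ℝ) => q.2 i :=
    (measurable_pi_apply i).comp measurable_snd
  refine (hv.mul ((measurable_pi_apply i).comp hx)).sub ?_
  refine (StronglyMeasurable.integral_prod_right' (f := fun p : (α × (Fin n → ℝ)) × ℝ =>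
    (Set.Ioc 0 (p.1.2 i)).indicator (fun s => x p.1.1 (Function.update p.1.2 i s) i) p.2)
    ?_).measurable
  have : (fun p : (α × (Fin n → ℝ)) × ℝ =>
      (Set.Ioc 0 (p.1.2 i)).indicator (fun s => x p.1.1 (Function.update p.1.2 i s) i) p.2) =
      ({p : (α × (Fin n → ℝ)) × ℝ | 0 < p.2 ∧ p.2 ≤ p.1.2 i}).indicator
        fun p => x p.1.1 (Function.update p.1.2 i p.2) i := by
    ext p; simp [Set.indicator]
  rw [this]
  have hu : Measurable fun p : (α × (Fin n → ℝ)) × ℝ =>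
      (p.1.1, Function.update p.1.2 i p.2) :=
    (measurable_fst.comp measurable_fst).prodMk
      ((measurable_update' (a := i)).comp
        ((measurable_snd.comp measurable_fst).prodMk measurable_snd))
  exact (((measurable_pi_apply i).comp (hx.comp hu)).indicator
    ((measurableSet_lt measurable_const measurable_snd).inter
      (measurableSet_le measurable_snd (hv.comp measurable_fst)))).stronglyMeasurable

/-- A monotone allocation rule, made incentive compatible. -/
def ofMonotone (x : (Fin n → ℝ) → Fin n → ℝ) (hx : Measurable x)
    (hx0 : ∀ v, 0 ≤ v → ∀ i, 0 ≤ x v i) (hx1 : ∀ v, 0 ≤ v → ∑ i, x v i ≤ 1)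
    (hmono : ∀ v, 0 ≤ v → ∀ i, MonotoneOn (fun b => x (Function.update v i b) i) (Set.Ici 0)) :
    ICMechanism n where
  alloc := x
  pay := envelopePay x
  measurable_alloc := hx
  measurable_pay :=
    (measurable_envelopePay (α := Unit) (x := fun _ => x) (hx.comp measurable_snd)).comp
      (measurable_const (a := ()) |>.prodMk measurable_id)
  alloc_nonneg := hx0
  sum_alloc_le_one := hx1
  pay_nonneg v hv i := by
    have h := (MonotoneOn.integral_mem_of_Ici (hmono v hv i) le_rfl (hv i)).2
    simp only [Function.update_eq_self, sub_zero] at h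
    rw [envelopePay_eq x hv]
    linarith
  truthful v hv i b hb := by
    have hm := hmono v hv i
    rw [envelopePay_eq x hv, envelopePay_eq x (update_nonneg hv i hb)]
    simp only [Function.update_self, Function.update_idem]
    have hadd := intervalIntegral.integral_add_adjacent_intervals
      (hm.intervalIntegrable_of_Ici le_rfl hb) (hm.intervalIntegrable_of_Ici hb (hv i))
    -- Truth minus deviation is `∫_b^{v i} x - (v i - b) * x b` along bidder `i`'s bid, which is
    -- nonnegative by monotonicity on either side of `b`.
    rcases le_total b (v i) with h | h
    · have h1 := (hm.integral_mem_of_Ici hb h).1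
      linarith
    · have h1 := (hm.integral_mem_of_Ici (hv i) h).2
      rw [intervalIntegral.integral_symm] at h1
      linarith
  rational v hv i := by
    rw [envelopePay_eq x hv]
    exact sub_le_self _ (intervalIntegral.integral_nonneg (hv i) fun s hs =>
      hx0 _ (update_nonneg hv i hs.1) i)

end ICMechanism

namespace AdMDP

variable {n : ℕ} (M : AdMDP n)

/-- The modified virtual value for an arbitrary continuation value `W`. -/
def virtualValueWith (W : UserState → ℝ) (i : Fin n) (vi : ℝ) (c : UserState) : EReal :=
  ((c : ℝ) : EReal) * (M.F i).virtualValue vi +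
    ((M.γ * (∫ c', W c' ∂(M.P {i} c) - ∫ c', W c' ∂(M.P ∅ c)) : ℝ) : EReal)

/-- The value `⊥` survives multiplication by `c` only if `c ≠ 0`. For `c = 0` the product is zero,
and the virtual value also drops out of the score. -/
theorem virtualValueWith_eq (W : UserState → ℝ) (i : Fin n) (v : Fin n → ℝ) (c : UserState) :
    M.virtualValueWith W i (v i) c =
      if ((M.F i).pdf (v i) = 0 ∧ cdf (M.F i).law (v i) < 1) ∧ (c : ℝ) ≠ 0 then ⊥
      else ((M.score W c v (some i) - M.score W c v none : ℝ) : EReal) := by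
  rw [virtualValueWith, ValueDist.virtualValue_eq]
  rcases eq_or_ne (c : ℝ) 0 with hc | hc
  · simp [hc, score, mul_sub]
  · by_cases h : (M.F i).pdf (v i) = 0 ∧ cdf (M.F i).law (v i) < 1
    · have hpos : (0 : ℝ) < c := lt_of_le_of_ne c.2.1 hc.symm
      rw [if_pos h, if_pos ⟨h, hc⟩, EReal.coe_mul_bot_of_pos hpos, EReal.bot_add]
    · rw [if_neg h, if_neg fun h' => h h'.1, ← EReal.coe_mul, ← EReal.coe_add]
      congr 1
      simp only [score]
      ring

theorem monotoneOn_virtualValueWith (W : UserState → ℝ) (i : Fin n) (c : UserState)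
    (hreg : (M.F i).IsRegular) :
    MonotoneOn (fun b => M.virtualValueWith W i b c) (Set.Ici 0) := by
  intro s hs t ht hst
  exact add_le_add_left (mul_le_mul_of_nonneg_left (hreg hs ht hst)
    (EReal.coe_nonneg.mpr c.2.1)) _

theorem measurable_virtualValueWith {W : UserState → ℝ} (hW : IsBddMeas W) (i : Fin n) :
    Measurable fun q : UserState × (Fin n → ℝ) => M.virtualValueWith W i (q.2 i) q.1 := by
  simp_rw [virtualValueWith_eq]
  have hv : Measurable fun q : UserState × (Fin n → ℝ) => q.2 i :=
    (measurable_pi_apply i).comp measurable_snd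
  refine Measurable.ite ?_ measurable_const
    ((M.measurable_score hW (some i)).sub (M.measurable_score hW none)).coe_real_ereal
  refine ((measurableSet_eq_fun ((M.F i).measurable_pdf.comp hv) measurable_const).inter
    (measurableSet_lt ((M.F i).measurable_cdf.comp hv) measurable_const)).inter ?_
  exact (measurableSet_eq_fun (measurable_subtype_coe.comp measurable_fst) measurable_const).compl

/-- Bidder `i` has a positive modified virtual value and is the first of those with the largest
modified virtual value. -/
def IsFirstMaximizer (W : UserState → ℝ) (c : UserState) (v : Fin n → ℝ) (i : Fin n) : Prop :=
  0 < M.virtualValueWith W i (v i) c ∧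
    ∀ j, M.virtualValueWith W j (v j) c ≤ M.virtualValueWith W i (v i) c ∧
      (j < i → M.virtualValueWith W j (v j) c < M.virtualValueWith W i (v i) c)

open Classical in
/-- The deterministic greedy allocation. -/
def greedyAlloc (W : UserState → ℝ) (c : UserState) (v : Fin n → ℝ) (i : Fin n) : ℝ :=
  if M.IsFirstMaximizer W c v i then 1 else 0

variable {M}

theorem IsFirstMaximizer.eq {W : UserState → ℝ} {c : UserState} {v : Fin n → ℝ} {i j : Fin n}
    (hi : M.IsFirstMaximizer W c v i) (hj : M.IsFirstMaximizer W c v j) : i = j := by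
  rcases lt_trichotomy i j with h | h | h
  · exact absurd ((hi.2 j).1) (not_le.mpr ((hj.2 i).2 h))
  · exact h
  · exact absurd ((hj.2 i).1) (not_le.mpr ((hi.2 j).2 h))

theorem exists_isFirstMaximizer {W : UserState → ℝ} {c : UserState} {v : Fin n → ℝ} {k : Fin n}
    (hk : 0 < M.virtualValueWith W k (v k) c) : ∃ i, M.IsFirstMaximizer W c v i := by
  classical
  obtain ⟨m, -, hm⟩ := Finset.exists_max_image Finset.univ
    (fun i => M.virtualValueWith W i (v i) c) ⟨k, Finset.mem_univ k⟩
  have hne : (Finset.univ.filter fun i =>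
      ∀ j, M.virtualValueWith W j (v j) c ≤ M.virtualValueWith W i (v i) c).Nonempty :=
    ⟨m, by simpa using hm⟩
  obtain ⟨i, hi, hmin⟩ := Finset.exists_min_image _ id hne
  simp only [Finset.mem_filter, Finset.mem_univ, true_and, id] at hi hmin
  refine ⟨i, hk.trans_le (hi k), fun j => ⟨hi j, fun hj => ?_⟩⟩
  by_contra hlt
  exact absurd (hmin j fun l => (hi l).trans (not_lt.mp hlt)) (not_le.mpr hj)

variable (M)

theorem sum_greedyAlloc {W : UserState → ℝ} {c : UserState} {v : Fin n → ℝ} {i : Fin n}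
    (hi : M.IsFirstMaximizer W c v i) : ∑ j, M.greedyAlloc W c v j = 1 := by
  rw [Finset.sum_eq_single i]
  · rw [greedyAlloc, if_pos hi]
  · intro j _ hj
    rw [greedyAlloc, if_neg fun h => hj (h.eq hi)]
  · simp

theorem greedyAlloc_nonneg (W : UserState → ℝ) (c : UserState) (v : Fin n → ℝ) (i : Fin n) :
    0 ≤ M.greedyAlloc W c v i := by
  unfold greedyAlloc; split_ifs <;> simp

theorem sum_greedyAlloc_le_one (W : UserState → ℝ) (c : UserState) (v : Fin n → ℝ) :
    ∑ i, M.greedyAlloc W c v i ≤ 1 := by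
  by_cases h : ∃ i, M.IsFirstMaximizer W c v i
  · obtain ⟨i, hi⟩ := h
    exact (M.sum_greedyAlloc hi).le
  · push Not at h
    simp [greedyAlloc, h]

/-- A higher bid of `i` does not lower `i`'s modified virtual value, by regularity, and leaves the
others unchanged. So a first maximizer stays one, tie-breaking included. -/
theorem monotoneOn_greedyAlloc (hreg : ∀ i, (M.F i).IsRegular) (W : UserState → ℝ)
    (c : UserState) (v : Fin n → ℝ) (i : Fin n) :
    MonotoneOn (fun b => M.greedyAlloc W c (Function.update v i b) i) (Set.Ici 0) := by
  intro s hs t ht hst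
  have hm := M.monotoneOn_virtualValueWith W i c (hreg i) hs ht hst
  simp only at hm
  by_cases h : M.IsFirstMaximizer W c (Function.update v i s) i
  · have h' : M.IsFirstMaximizer W c (Function.update v i t) i := by
      obtain ⟨h0, h1⟩ := h
      simp only [Function.update_self] at h0 h1
      refine ⟨by simpa using h0.trans_le hm, fun j => ?_⟩
      rcases eq_or_ne j i with rfl | hj
      · simp
      · have := h1 j
        simp only [Function.update_of_ne hj, Function.update_self] at this ⊢
        exact ⟨this.1.trans hm, fun hlt => (this.2 hlt).trans_le hm⟩
    simp [greedyAlloc, h, h']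
  · simpa [greedyAlloc, h] using M.greedyAlloc_nonneg W c (Function.update v i t) i

theorem measurable_greedyAlloc {W : UserState → ℝ} (hW : IsBddMeas W) :
    Measurable fun q : UserState × (Fin n → ℝ) => M.greedyAlloc W q.1 q.2 := by
  refine measurable_pi_lambda _ fun i => ?_
  have hm := fun j => M.measurable_virtualValueWith hW j
  refine Measurable.ite ?_ measurable_const measurable_const
  refine (measurableSet_lt measurable_const (hm i)).inter ?_
  have : {q : UserState × (Fin n → ℝ) | ∀ j,
      M.virtualValueWith W j (q.2 j) q.1 ≤ M.virtualValueWith W i (q.2 i) q.1 ∧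
      (j < i → M.virtualValueWith W j (q.2 j) q.1 < M.virtualValueWith W i (q.2 i) q.1)} =
      ⋂ j, ({q | M.virtualValueWith W j (q.2 j) q.1 ≤ M.virtualValueWith W i (q.2 i) q.1} ∩
        ⋂ _ : j < i,
          {q | M.virtualValueWith W j (q.2 j) q.1 < M.virtualValueWith W i (q.2 i) q.1}) := by
    ext q; simp
  change MeasurableSet {q : UserState × (Fin n → ℝ) | ∀ j,
      M.virtualValueWith W j (q.2 j) q.1 ≤ M.virtualValueWith W i (q.2 i) q.1 ∧
      (j < i → M.virtualValueWith W j (q.2 j) q.1 < M.virtualValueWith W i (q.2 i) q.1)}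
  rw [this]
  exact MeasurableSet.iInter fun j => (measurableSet_le (hm j) (hm i)).inter
    (MeasurableSet.iInter fun _ => measurableSet_lt (hm j) (hm i))

/-- The policy that allocates greedily with respect to the continuation value `W`. -/
def greedyPolicy (hreg : ∀ i, (M.F i).IsRegular) {W : UserState → ℝ} (hW : IsBddMeas W) :
    Policy n where
  mech c := ICMechanism.ofMonotone (M.greedyAlloc W c)
    ((M.measurable_greedyAlloc hW).comp measurable_prodMk_left)
    (fun v _ => M.greedyAlloc_nonneg W c v) (fun v _ => M.sum_greedyAlloc_le_one W c v)
    (fun v _ => M.monotoneOn_greedyAlloc hreg W c v)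
  measurable_alloc := M.measurable_greedyAlloc hW
  measurable_pay := ICMechanism.measurable_envelopePay (M.measurable_greedyAlloc hW)

/-! ### Greedy allocation as the equality case of the one-period bound. -/

/-- The allocation rule of the theorem for an arbitrary continuation value `W`. -/
def IsGreedy (W : UserState → ℝ) (a : ICMechanism n) (c : UserState) : Prop :=
  ∀ v : Fin n → ℝ, 0 ≤ v →
    ((∃ i, 0 < M.virtualValueWith W i (v i) c) →
      ∑ i, a.alloc v i = 1 ∧ ∀ i, a.alloc v i ≠ 0 →
        ∀ j, M.virtualValueWith W j (v j) c ≤ M.virtualValueWith W i (v i) c) ∧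
    ((∀ i, M.virtualValueWith W i (v i) c ≤ 0) → ∀ i, a.alloc v i = 0)

theorem isGreedy_greedyPolicy (hreg : ∀ i, (M.F i).IsRegular) {W : UserState → ℝ}
    (hW : IsBddMeas W) (c : UserState) : M.IsGreedy W ((M.greedyPolicy hreg hW).mech c) c := by
  intro v _
  change (_ → ∑ i, M.greedyAlloc W c v i = 1 ∧ ∀ i, M.greedyAlloc W c v i ≠ 0 → _) ∧
    (_ → ∀ i, M.greedyAlloc W c v i = 0)
  constructor
  · rintro ⟨k, hk⟩
    obtain ⟨i, hi⟩ := exists_isFirstMaximizer hk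
    refine ⟨M.sum_greedyAlloc hi, fun l hl j => ?_⟩
    have : M.IsFirstMaximizer W c v l := by
      by_contra h
      exact hl (if_neg h)
    exact (this.2 j).1
  · intro h i
    exact if_neg fun hi => absurd hi.1 (not_lt.mpr (h i))

theorem ae_pdf_pos : ∀ᵐ v ∂M.valueLaw, ∀ i, 0 < (M.F i).pdf (v i) :=
  ae_all_iff.mpr fun i =>
    (measurePreserving_eval (fun i => (M.F i).law) i).quasiMeasurePreserving.ae (M.F i).ae_pdf_pos

theorem virtualValueWith_eq_of_pdf_pos (W : UserState → ℝ) (c : UserState) {v : Fin n → ℝ}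
    {i : Fin n} (hv : 0 < (M.F i).pdf (v i)) : M.virtualValueWith W i (v i) c =
      ((M.score W c v (some i) - M.score W c v none : ℝ) : EReal) := by
  rw [virtualValueWith_eq, if_neg fun h => hv.ne' h.1.1]

/-- If some modified virtual value is positive, every bidder who is served has one at least as
large; otherwise nobody is served. -/
theorem IsGreedy.alloc_eq_zero {W : UserState → ℝ} {a : ICMechanism n} {c : UserState}
    (h : M.IsGreedy W a c) {v : Fin n → ℝ} (hv : 0 ≤ v) {i : Fin n}
    (hi : M.virtualValueWith W i (v i) c ≤ 0) : a.alloc v i = 0 := by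
  by_cases hp : ∃ k, 0 < M.virtualValueWith W k (v k) c
  · obtain ⟨k, hk⟩ := hp
    by_contra hne
    exact absurd (hk.trans_le (((h v hv).1 ⟨k, hk⟩).2 i hne k)) (not_lt.mpr hi)
  · push Not at hp
    exact (h v hv).2 hp i

theorem IsGreedy.qValue_eq (hmean : ∀ i, Integrable (fun v : ℝ => v) (M.F i).law)
    {W : UserState → ℝ} (hW : IsBddMeas W) {a : ICMechanism n} {c : UserState}
    (h : M.IsGreedy W a c) : M.qValue W c a = M.bellman W c := by
  refine M.qValue_eq_bellman hmean hW (fun hc i v hv h0 h1 => h.alloc_eq_zero M hv ?_) ?_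
  · rw [virtualValueWith_eq, if_pos ⟨⟨h0, h1⟩, hc⟩]
    exact bot_le
  filter_upwards [M.ae_nonneg, M.ae_pdf_pos] with v hv hpdf
  have hval := fun i => M.virtualValueWith_eq_of_pdf_pos W c (hpdf i)
  rw [M.allocScore_eq_iff W c a hv]
  constructor
  · intro i hi
    have hpos : 0 < M.virtualValueWith W i (v i) c := by
      by_contra hn
      exact hi (h.alloc_eq_zero M hv (not_lt.mp hn))
    have hmax := ((h v hv).1 ⟨i, hpos⟩).2 i hi
    simp only [hval, EReal.coe_pos, EReal.coe_le_coe_iff, sub_le_sub_iff_right] at hpos hmax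
    refine le_antisymm (M.score_le_iSup W c v _) (ciSup_le fun o => ?_)
    cases o with
    | none => linarith
    | some j => exact hmax j
  · intro hs
    have hnp : ∀ i, M.virtualValueWith W i (v i) c ≤ 0 := fun i =>
      not_lt.mp fun hi => hs ((h v hv).1 ⟨i, hi⟩).1
    refine le_antisymm (M.score_le_iSup W c v _) (ciSup_le fun o => ?_)
    cases o with
    | none => exact le_rfl
    | some j =>
      have := hnp j
      rw [hval, ← EReal.coe_zero, EReal.coe_le_coe_iff] at this
      linarith

/-- Almost surely all densities are positive, so the modified virtual values are differences of
scores and the equality case applies. At value zero showing the ad and showing none are equally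
good, hence only nonnegativity. -/
theorem ae_greedy_of_qValue_eq (hmean : ∀ i, Integrable (fun v : ℝ => v) (M.F i).law)
    {W : UserState → ℝ} (hW : IsBddMeas W) {a : ICMechanism n} {c : UserState}
    (h : M.qValue W c a = M.bellman W c) : ∀ᵐ v ∂M.valueLaw,
      ((∃ i, 0 < M.virtualValueWith W i (v i) c) → ∑ i, a.alloc v i = 1) ∧
      ∀ i, a.alloc v i ≠ 0 →
        (∀ j, M.virtualValueWith W j (v j) c ≤ M.virtualValueWith W i (v i) c) ∧
          0 ≤ M.virtualValueWith W i (v i) c := by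
  filter_upwards [M.ae_nonneg, M.ae_pdf_pos, M.ae_allocScore_eq_of_qValue_eq hmean hW h]
    with v hv hpdf heq
  have hval := fun i => M.virtualValueWith_eq_of_pdf_pos W c (hpdf i)
  obtain ⟨h1, h2⟩ := (M.allocScore_eq_iff W c a hv).mp heq
  constructor
  · rintro ⟨i, hi⟩
    rw [hval, EReal.coe_pos] at hi
    by_contra hs
    have h3 := M.score_le_iSup W c v (some i)
    have h4 := h2 hs
    linarith
  · intro i hi
    have h3 := h1 i hi
    refine ⟨fun j => ?_, ?_⟩
    · rw [hval, hval, EReal.coe_le_coe_iff, sub_le_sub_iff_right, h3]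
      exact M.score_le_iSup W c v _
    · rw [hval, EReal.coe_nonneg, sub_nonneg, h3]
      exact M.score_le_iSup W c v _

/-! ### The optimal value function and the theorem. -/

section Optimal

variable (hmean : ∀ i, Integrable (fun v : ℝ => v) (M.F i).law)
include hmean

theorem value_le_of_bellman_eq {W : UserState → ℝ} (hW : IsBddMeas W)
    (hfix : ∀ c, M.bellman W c = W c) (π : Policy n) (c : UserState) :
    M.value π c ≤ M.qValue W c (π.mech c) :=
  M.value_le_qValue hmean hW π (fun c => (M.qValue_le_bellman hmean hW c _).trans_eq (hfix c)) c

/-- The optimal value function is the fixed point of the Bellman operator. -/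
theorem optValue_eq (hreg : ∀ i, (M.F i).IsRegular) {W : UserState → ℝ} (hW : IsBddMeas W)
    (hfix : ∀ c, M.bellman W c = W c) : M.optValue = W := by
  ext c
  have hle : ∀ π, M.value π c ≤ W c := fun π =>
    (M.value_le_of_bellman_eq hmean hW hfix π c).trans
      ((M.qValue_le_bellman hmean hW c _).trans_eq (hfix c))
  have heq : M.value (M.greedyPolicy hreg hW) c = W c :=
    M.value_eq_of_qValue_eq hmean hW _
      (fun c => ((M.isGreedy_greedyPolicy hreg hW c).qValue_eq M hmean hW).trans (hfix c)) c
  have : Nonempty (Policy n) := ⟨M.greedyPolicy hreg hW⟩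
  refine le_antisymm (ciSup_le hle) ?_
  rw [← heq]
  exact le_ciSup (f := fun π => M.value π c) ⟨W c, by rintro _ ⟨π, rfl⟩; exact hle π⟩ _

end Optimal

end AdMDP

end

theorem corollary1 {n : ℕ} (M : AdMDP n)
    (hreg : ∀ i, (M.F i).IsRegular)
    (hmean : ∀ i, Integrable (fun v : ℝ => v) (M.F i).law) :
    -- some policy of deterministic mechanisms follows the rule in every state
    (∃ π : Policy n, ∀ c, M.AllocatesToMaximizer (π.mech c) c ∧
      ∀ v, 0 ≤ v → ∀ i, (π.mech c).alloc v i = 0 ∨ (π.mech c).alloc v i = 1) ∧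
    -- every policy that follows the rule in every state is optimal
    (∀ π : Policy n, (∀ c, M.AllocatesToMaximizer (π.mech c) c) →
      M.IsOptimal π ∧ ∀ c, M.value π c = M.optValue c) ∧
    -- every optimal policy follows the rule in every state, for almost all values
    -- and up to allocations at modified virtual value zero
    (∀ π : Policy n, M.IsOptimal π → ∀ c, ∀ᵐ v ∂M.valueLaw,
      ((∃ i, 0 < M.modifiedVirtualValue i (v i) c) → ∑ i, (π.mech c).alloc v i = 1) ∧
      ∀ i, (π.mech c).alloc v i ≠ 0 →
        M.IsMaximizer v c i ∧ 0 ≤ M.modifiedVirtualValue i (v i) c) := by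
  obtain ⟨W, hW, hfix⟩ := M.exists_bellman_eq hmean
  -- With `W` replaced by `M.optValue`, `virtualValueWith` and `IsGreedy` agree by definition with
  -- `modifiedVirtualValue` and `AllocatesToMaximizer`.
  obtain rfl := M.optValue_eq hmean hreg hW hfix
  have hle : ∀ π c, M.value π c ≤ M.optValue c := fun π c =>
    (M.value_le_of_bellman_eq hmean hW hfix π c).trans
      ((M.qValue_le_bellman hmean hW c _).trans_eq (hfix c))
  have hgreedy : ∀ π : Policy n, (∀ c, M.AllocatesToMaximizer (π.mech c) c) →
      ∀ c, M.value π c = M.optValue c := fun π hπ c =>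
    M.value_eq_of_qValue_eq hmean hW π
      (fun c => (AdMDP.IsGreedy.qValue_eq M hmean hW (hπ c)).trans (hfix c)) c
  refine ⟨⟨M.greedyPolicy hreg hW, fun c => ⟨M.isGreedy_greedyPolicy hreg hW c,
    fun v _ i => ?_⟩⟩, fun π hπ => ⟨fun c π' => (hle π' c).trans_eq (hgreedy π hπ c).symm,
    hgreedy π hπ⟩, fun π hπ c => ?_⟩
  · by_cases h : M.IsFirstMaximizer M.optValue c v i
    · exact Or.inr (if_pos h)
    · exact Or.inl (if_neg h)
  · refine M.ae_greedy_of_qValue_eq hmean hW (le_antisymm (M.qValue_le_bellman hmean hW c _) ?_)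
    -- Here `V^*(c)` is the value of the greedy policy, which is at most `V^π(c)` by optimality,
    -- which is at most the `qValue` of `π` at `c`.
    rw [hfix, ← hgreedy _ (M.isGreedy_greedyPolicy hreg hW) c]
    exact (hπ c _).trans (M.value_le_of_bellman_eq hmean hW hfix π c)
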